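/- The programmes telecast by all television channels during one day are given: $n\ge 1$ programmes, where programme $i$ belongs to a channel, occupies a time interval $[s_i,f_i]$ with $s_i,f_i\in\mathbb R$, $0\le s_i<f_i\le 24$, and has $w_i\in\mathbb N$ viewers. Two programmes intersect if $s_i<f_j$ and $s_j<f_i$ (so a programme that starts when another one finishes does not intersect it); two distinct programmes of the same channel do not intersect. For $k\ge 1$, a selection for $k$ parallel sessions is a family $H_1,\dots,H_k$ of pairwise disjoint, possibly empty, sets of programmes such that any two distinct programmes in the same $H_c$ do not intersect. Its number of viewers is $\sum_{c=1}^{k}\sum_{i\in H_c}w_i$. Theorem. There are a single algorithm and a constant $C$ such that for all $n\ge1$, $k\ge1$, $M\ge1$ and every such collection of $n$ programmes with $w_i\le M$ for all $i$, the algorithm, given $n$, $k$, the numbers $w_i$ and the times $s_i,f_i$, halts after at most $C\,k\,M\,n^2$ steps and outputs a selection $H_1,\dots,H_k$ for $k$ parallel sessions whose number of viewers is maximum among all selections for $k$ parallel sessions. That is, programme slots for $k$ parallel sessions with the maximum number of viewers can be selected in $O(kMn^2)$ time. Here an algorithm is a program of a random access machine with the uniform cost measure: integer registers and integer arrays, where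 reading or writing a register or an array cell, an addition, a subtraction, and a comparison each take one step (there is no multiplication); the real times $s_i,f_i$ can only be compared with each other, one step per comparison. -/

import Mathlib

namespace TVSlots

/-! ### Programme slots and the selection problem -/

/-- The programmes of all channels within one day, numbered by `Fin n`.  Programme `i` is telecast on
`channel i` during the interval `[start i, finish i]` (hours, in `[0, 24]`) and has `viewers i`
viewers.  Two programmes of one channel do not overlap (they may touch). -/
structure Schedule (n : ℕ) where
  channel : Fin n → ℕ
  start : Fin n → ℝ
  finish : Fin n → ℝ
  viewers : Fin n → ℕ
  start_nonneg : ∀ i, 0 ≤ start i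
  start_lt_finish : ∀ i, start i < finish i
  finish_le : ∀ i, finish i ≤ 24
  channel_disjoint : ∀ i j, i ≠ j → channel i = channel j →
    finish i ≤ start j ∨ finish j ≤ start i

/-- The interval graph of a schedule: two programmes are adjacent if their times intersect, where a
programme that starts when another one finishes does not intersect it. -/
def Schedule.graph {n : ℕ} (S : Schedule n) : SimpleGraph (Fin n) where
  Adj i j := i ≠ j ∧ S.start i < S.finish j ∧ S.start j < S.finish i
  symm := ⟨fun _ _ h => ⟨h.1.symm, h.2.2, h.2.1⟩⟩
  loopless := ⟨fun _ h => h.1 rfl⟩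

/-- `H 0, …, H (k - 1)` is a selection of programmes for `k` parallel sessions: no programme is put
into two sessions, and any two programmes of the same session are disjoint in time.  (These are the
colour classes of a `k`-coloured subgraph; a session may be empty.) -/
structure Schedule.IsSelection {n : ℕ} (S : Schedule n) {k : ℕ}
    (H : Fin k → Finset (Fin n)) : Prop where
  disjoint : ∀ c d, c ≠ d → Disjoint (H c) (H d)
  session : ∀ c, S.graph.IsIndepSet (H c : Set (Fin n))

/-- The total number of viewers of the selected programmes. -/
def Schedule.total {n : ℕ} (S : Schedule n) {k : ℕ} (H : Fin k → Finset (Fin n)) : ℕ :=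
  ∑ c, ∑ i ∈ H c, S.viewers i

/-- A selection for `k` parallel sessions with the maximum number of viewers. -/
def Schedule.IsOptimal {n : ℕ} (S : Schedule n) {k : ℕ} (H : Fin k → Finset (Fin n)) : Prop :=
  S.IsSelection H ∧ ∀ H' : Fin k → Finset (Fin n), S.IsSelection H' → S.total H' ≤ S.total H

/-! ### The machine model

A random access machine with integer registers and integer arrays, with the uniform cost measure: an
addition, a subtraction, a comparison, a read or write of a register or an array cell costs one step.
Programs are structured (sequence, conditional, loop).  There is no multiplication.  The telecast
times are real numbers in two read-only tables, which a program can use in no way but by comparing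
two entries. -/

/-- The two read-only tables of times. -/
inductive TimeTable
  | start
  | finish

/-- Integer expressions: constants, registers, array cells, sums and differences. -/
inductive Expr
  | const (z : ℤ)
  | reg (x : ℕ)
  | get (a : ℕ) (i : Expr)
  | add (e f : Expr)
  | sub (e f : Expr)

/-- Tests: comparison of two integers, comparison of two entries of the tables of times, and
Boolean combinations. -/
inductive Test
  | le (e f : Expr)
  | timeLe (p : TimeTable) (e : Expr) (q : TimeTable) (f : Expr)
  | not (b : Test)
  | and (b c : Test)

/-- Programs: `set x e` writes the value of `e` into register `x`, and `put a i e` writes the value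
of `e` into cell `i` of array `a`. -/
inductive Prog
  | skip
  | set (x : ℕ) (e : Expr)
  | put (a : ℕ) (i e : Expr)
  | seq (p q : Prog)
  | ite (b : Test) (p q : Prog)
  | while (b : Test) (p : Prog)

/-- The contents of the memory: register `x` holds `reg x`, cell `i` of array `a` holds
`arr a i`. -/
structure State where
  reg : ℕ → ℤ
  arr : ℕ → ℤ → ℤ

/-- The value of an expression. -/
def Expr.eval (s : State) : Expr → ℤ
  | .const z => z
  | .reg x => s.reg x
  | .get a i => s.arr a (i.eval s)
  | .add e f => e.eval s + f.eval s
  | .sub e f => e.eval s - f.eval s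

/-- The number of steps needed to evaluate an expression. -/
def Expr.cost : Expr → ℕ
  | .const _ => 1
  | .reg _ => 1
  | .get _ i => i.cost + 1
  | .add e f => e.cost + f.cost + 1
  | .sub e f => e.cost + f.cost + 1

/-- The truth of a test, where `T` holds the tables of times. -/
def Test.Holds (T : TimeTable → ℤ → ℝ) (s : State) : Test → Prop
  | .le e f => e.eval s ≤ f.eval s
  | .timeLe p e q f => T p (e.eval s) ≤ T q (f.eval s)
  | .not b => ¬ b.Holds T s
  | .and b c => b.Holds T s ∧ c.Holds T s

/-- The number of steps needed to evaluate a test. -/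
def Test.cost : Test → ℕ
  | .le e f => e.cost + f.cost + 1
  | .timeLe _ e _ f => e.cost + f.cost + 1
  | .not b => b.cost + 1
  | .and b c => b.cost + c.cost + 1

/-- The memory after the value `z` has been written into register `x`. -/
def State.setReg (s : State) (x : ℕ) (z : ℤ) : State :=
  { s with reg := Function.update s.reg x z }

/-- The memory after the value `z` has been written into cell `i` of array `a`. -/
def State.setArr (s : State) (a : ℕ) (i z : ℤ) : State :=
  { s with arr := Function.update s.arr a (Function.update (s.arr a) i z) }

/-- `Runs T p s t s'`: with the tables of times `T`, the program `p` started on the memory `s` halts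
after exactly `t` steps, leaving the memory `s'`. -/
inductive Runs (T : TimeTable → ℤ → ℝ) : Prog → State → ℕ → State → Prop
  | skip (s : State) : Runs T .skip s 1 s
  | set (x : ℕ) (e : Expr) (s : State) :
      Runs T (.set x e) s (e.cost + 1) (s.setReg x (e.eval s))
  | put (a : ℕ) (i e : Expr) (s : State) :
      Runs T (.put a i e) s (i.cost + e.cost + 1) (s.setArr a (i.eval s) (e.eval s))
  | seq {p q : Prog} {s s' s'' : State} {t t' : ℕ} :
      Runs T p s t s' → Runs T q s' t' s'' → Runs T (.seq p q) s (t + t') s''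
  | ite_true {b : Test} {p q : Prog} {s s' : State} {t : ℕ} :
      b.Holds T s → Runs T p s t s' → Runs T (.ite b p q) s (b.cost + t + 1) s'
  | ite_false {b : Test} {p q : Prog} {s s' : State} {t : ℕ} :
      ¬ b.Holds T s → Runs T q s t s' → Runs T (.ite b p q) s (b.cost + t + 1) s'
  | while_true {b : Test} {p : Prog} {s s' s'' : State} {t t' : ℕ} :
      b.Holds T s → Runs T p s t s' → Runs T (.while b p) s' t' s'' →
      Runs T (.while b p) s (b.cost + t + 1 + t') s''
  | while_false {b : Test} {p : Prog} {s : State} :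
      ¬ b.Holds T s → Runs T (.while b p) s (b.cost + 1) s

/-! ### Input and output -/

/-- A list of `n` values as an array: cells `0, …, n - 1` hold the values, all others hold `0`. -/
def toArray {α : Type} [Zero α] {n : ℕ} (f : Fin n → α) (z : ℤ) : α :=
  if h : 0 ≤ z ∧ z.toNat < n then f ⟨z.toNat, h.2⟩ else 0

/-- The tables of times of a schedule. -/
def Schedule.times {n : ℕ} (S : Schedule n) : TimeTable → ℤ → ℝ
  | .start => toArray S.start
  | .finish => toArray S.finish

/-- The initial memory: register `0` holds the number `n` of programmes, register `1` the number `k`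
of sessions, array `0` the numbers of viewers, and everything else is `0`. -/
def Schedule.initial {n : ℕ} (S : Schedule n) (k : ℕ) : State where
  reg x := if x = 0 then n else if x = 1 then k else 0
  arr a := if a = 0 then toArray fun i => (S.viewers i : ℤ) else fun _ => 0

/-- The memory `s` presents the selection `H` as output: cell `i` of array `1` holds `c + 1` if
programme `i` is in session `H c`, and `0` if programme `i` is not selected. -/
def State.Outputs (s : State) {n k : ℕ} (H : Fin k → Finset (Fin n)) : Prop :=
  ∀ i : Fin n, (∃ c, i ∈ H c ∧ s.arr 1 (i : ℕ) = ((c : ℕ) : ℤ) + 1) ∨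
    ((∀ c, i ∉ H c) ∧ s.arr 1 (i : ℕ) = 0)

end TVSlots

/-! Sort the `2 n` endpoints into nodes, ends before starts at equal times. A set of programmes can
be split into `k` sessions if and only if at most `k` of its intervals cover each gap between
consecutive nodes. Necessity holds because intervals over a common gap need different sessions
(`Net.Represents.depth_le`). Sufficiency comes from a sweep that keeps the free sessions on a stack
(`colour_halts`). The problem is thus a flow problem: `k` units run from the first node to the last,
each moving along a programme or idly across a gap.

The dual variables are nondecreasing node prices that rise only across full gaps, and `price (finish
i) - price (start i)` is the cost of interval `i`. `Net.Kilter` is complementary slackness: selected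
intervals cost at most their weight, the others at least their weight. It implies optimality
(`Net.Kilter.sum_le`), because a total weight splits into reduced weights plus price increments
times depths, and a flow in kilter maximises both parts.

For zero weights, the zero flow with zero prices is in kilter. Weights are then raised to the
numbers of viewers one unit at a time. A unit step breaks slackness only at an unselected `j` whose
weight becomes its cost plus one. A breadth-first search from the end of `j` then uses the residual
arcs of reduced cost zero. If it reaches the start of `j`, selecting `j` closes a cycle and one unit
of flow is shifted along it (`Net.Walk`). If not, raising the prices of all found nodes by one
restores slackness, since all data are integers (`Net.Kilter.raise`). So one search of `O(n)` steps
repairs each of at most `M n` unit raises. Ranking endpoints pairwise costs `O(n ^ 2)` and colouring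
`O(k + n)`.

Programs are verified with `Prog.wp` for loop-free code, `Halts.while` and `Halts.for` for loops,
and `Agree` for whatever a program leaves untouched. -/

namespace TVSlots

/-! ### Total correctness with time bounds -/

/-- Started on `s`, the program `p` halts within `B` steps in a memory that satisfies `Q`. -/
def Halts (T : TimeTable → ℤ → ℝ) (p : Prog) (s : State) (B : ℕ) (Q : State → Prop) : Prop :=
  ∃ t s', Runs T p s t s' ∧ t ≤ B ∧ Q s'

/-- The registers that a program may write. -/
def Prog.regs : Prog → List ℕ
  | .skip => []
  | .set x _ => [x]
  | .put _ _ _ => []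
  | .seq p q => p.regs ++ q.regs
  | .ite _ p q => p.regs ++ q.regs
  | .while _ p => p.regs

/-- The arrays that a program may write. -/
def Prog.arrs : Prog → List ℕ
  | .skip => []
  | .set _ _ => []
  | .put a _ _ => [a]
  | .seq p q => p.arrs ++ q.arrs
  | .ite _ p q => p.arrs ++ q.arrs
  | .while _ p => p.arrs

/-- The memories `s` and `s'` agree on everything that `p` does not write. -/
def Agree (p : Prog) (s s' : State) : Prop :=
  (∀ x, x ∉ p.regs → s'.reg x = s.reg x) ∧ ∀ a, a ∉ p.arrs → s'.arr a = s.arr a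

theorem Agree.refl (p : Prog) (s : State) : Agree p s s := ⟨fun _ _ => rfl, fun _ _ => rfl⟩

theorem Agree.trans {p : Prog} {s s' s'' : State} (h : Agree p s s') (h' : Agree p s' s'') :
    Agree p s s'' :=
  ⟨fun x hx => (h'.1 x hx).trans (h.1 x hx), fun a ha => (h'.2 a ha).trans (h.2 a ha)⟩

theorem Agree.weaken {p q : Prog} {s s' : State} (h : Agree p s s')
    (hr : ∀ x ∈ p.regs, x ∈ q.regs) (ha : ∀ a ∈ p.arrs, a ∈ q.arrs) : Agree q s s' :=
  ⟨fun x hx => h.1 x fun h' => hx (hr x h'), fun a hx => h.2 a fun h' => hx (ha a h')⟩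

/-- This is the frame rule: since the lists of written registers and arrays are computable, `decide`
settles what survives a program, and invariants need mention only what changes. -/
theorem Runs.agree {T : TimeTable → ℤ → ℝ} {p : Prog} {s s' : State} {t : ℕ}
    (h : Runs T p s t s') : Agree p s s' := by
  induction h with
  | skip s => exact Agree.refl _ _
  | set x e s =>
    refine ⟨fun y hy => ?_, fun _ _ => rfl⟩
    simp only [Prog.regs, List.mem_singleton] at hy
    simp [State.setReg, hy]
  | put a i e s =>
    refine ⟨fun _ _ => rfl, fun b hb => ?_⟩
    simp only [Prog.arrs, List.mem_singleton] at hb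
    simp [State.setArr, hb]
  | seq _ _ ih ih' =>
    exact (ih.weaken (by simp +contextual [Prog.regs]) (by simp +contextual [Prog.arrs])).trans
      (ih'.weaken (by simp +contextual [Prog.regs]) (by simp +contextual [Prog.arrs]))
  | ite_true _ _ ih =>
    exact ih.weaken (by simp +contextual [Prog.regs]) (by simp +contextual [Prog.arrs])
  | ite_false _ _ ih =>
    exact ih.weaken (by simp +contextual [Prog.regs]) (by simp +contextual [Prog.arrs])
  | while_true _ _ _ ih ih' =>
    exact (ih.weaken (by simp [Prog.regs]) (by simp [Prog.arrs])).trans ih'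
  | while_false _ => exact Agree.refl _ _

section

variable {T : TimeTable → ℤ → ℝ} {p q : Prog} {s : State} {B B' : ℕ} {Q Q' : State → Prop}

theorem Halts.mono (h : Halts T p s B Q) (hB : B ≤ B') (hQ : ∀ s', Q s' → Q' s') :
    Halts T p s B' Q' := by
  obtain ⟨t, s', hr, ht, hs⟩ := h
  exact ⟨t, s', hr, ht.trans hB, hQ _ hs⟩

theorem Halts.agree (h : Halts T p s B Q) : Halts T p s B fun s' => Q s' ∧ Agree p s s' := by
  obtain ⟨t, s', hr, ht, hs⟩ := h
  exact ⟨t, s', hr, ht, hs, hr.agree⟩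

theorem Halts.seq {R : State → Prop} (h : Halts T p s B R)
    (h' : ∀ s', R s' → Halts T q s' B' Q) : Halts T (.seq p q) s (B + B') Q := by
  obtain ⟨t, s', hr, ht, hs⟩ := h
  obtain ⟨t', s'', hr', ht', hs'⟩ := h' s' hs
  exact ⟨t + t', s'', .seq hr hr', by omega, hs'⟩

theorem Halts.ite {b : Test} (ht : b.Holds T s → Halts T p s B Q)
    (hf : ¬ b.Holds T s → Halts T q s B Q) : Halts T (.ite b p q) s (b.cost + B + 1) Q := by
  by_cases hb : b.Holds T s
  · obtain ⟨t, s', hr, h, hs⟩ := ht hb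
    exact ⟨_, s', .ite_true hb hr, by omega, hs⟩
  · obtain ⟨t, s', hr, h, hs⟩ := hf hb
    exact ⟨_, s', .ite_false hb hr, by omega, hs⟩

/-- The rule for loops; `m` bounds the number of remaining rounds. -/
theorem Halts.while {b : Test} (I : ℕ → State → Prop)
    (hI : ∀ m s', Agree p s s' → I m s' → b.Holds T s' →
      ∃ m', m = m' + 1 ∧ Halts T p s' B (I m')) (m : ℕ) (hs : I m s) :
    Halts T (.while b p) s (m * (b.cost + B + 1) + (b.cost + 1))
      fun s' => (∃ m, I m s') ∧ ¬ b.Holds T s' := by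
  suffices H : ∀ m s', Agree p s s' → I m s' →
      Halts T (.while b p) s' (m * (b.cost + B + 1) + (b.cost + 1))
        fun s' => (∃ m, I m s') ∧ ¬ b.Holds T s' from H m s (Agree.refl _ _) hs
  intro m
  induction m with
  | zero =>
    intro s' ha hs'
    by_cases hb : b.Holds T s'
    · obtain ⟨m', hm, -⟩ := hI 0 s' ha hs' hb
      omega
    · exact ⟨_, s', .while_false hb, by omega, ⟨_, hs'⟩, hb⟩
  | succ m ih =>
    intro s' ha hs'
    by_cases hb : b.Holds T s'
    · obtain ⟨m', hm, t, s'', hr, ht, hs''⟩ := hI (m + 1) s' ha hs' hb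
      obtain rfl : m = m' := by omega
      obtain ⟨t', s₃, hr', ht', hs₃⟩ := ih s'' (ha.trans hr.agree) hs''
      refine ⟨_, s₃, .while_true hb hr hr', ?_, hs₃⟩
      rw [Nat.succ_mul]
      omega
    · exact ⟨_, s', .while_false hb, by omega, ⟨_, hs'⟩, hb⟩

end

/-- Sequential composition of programs. -/
infixr:65 " ;; " => Prog.seq

/-- The test whether one integer is less than another. -/
def Test.lt (e f : Expr) : Test := .not (.le f e)

/-- The test whether two integers are equal. -/
def Test.eq (e f : Expr) : Test := .and (.le e f) (.le f e)

@[simp] theorem Test.holds_lt {T : TimeTable → ℤ → ℝ} {s : State} {e f : Expr} :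
    (Test.lt e f).Holds T s ↔ e.eval s < f.eval s := by
  simp [Test.lt, Test.Holds]

@[simp] theorem Test.holds_eq {T : TimeTable → ℤ → ℝ} {s : State} {e f : Expr} :
    (Test.eq e f).Holds T s ↔ e.eval s = f.eval s := by
  simp [Test.eq, Test.Holds, le_antisymm_iff]

/-- Run `p` with register `x` equal to `0, 1, …` up to the value of register `y`, exclusively. -/
def Prog.for (x y : ℕ) (p : Prog) : Prog :=
  .set x (.const 0) ;; .while (.lt (.reg x) (.reg y)) (p ;; .set x (.add (.reg x) (.const 1)))

/-- The invariant is required after the counter has been incremented. Each round costs 9 steps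
besides the body (test 4, increment 4, loop 1); the other 7 are the initialisation and the failing
last test. -/
theorem Halts.for {T : TimeTable → ℤ → ℝ} {p : Prog} {s : State} {B : ℕ} (x y N : ℕ)
    (I : ℕ → State → Prop) (hx : x ∉ p.regs) (hy : y ∉ p.regs) (hxy : y ≠ x)
    (hN : s.reg y = N) (h0 : I 0 (s.setReg x 0))
    (hI : ∀ (i : ℕ) (s' : State), i < N → Agree (.for x y p) s s' → s'.reg x = i → I i s' →
      Halts T p s' B fun s'' => I (i + 1) (s''.setReg x ((i + 1 : ℕ) : ℤ))) :
    Halts T (.for x y p) s (N * (B + 9) + 7) fun s' => I N s' ∧ Agree (.for x y p) s s' := by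
  refine Halts.mono (Halts.agree (Q := I N) ?_) le_rfl fun s' h => h
  refine Halts.mono (Halts.seq (B := 2) (R := fun s' => s' = s.setReg x 0)
    ⟨_, _, .set x (.const 0) s, le_rfl, rfl⟩ ?_) (le_of_eq (Nat.add_comm 2 (N * (B + 9) + 5)))
    fun s' h => h
  rintro _ rfl
  have hag : ∀ s' : State,
      Agree (p ;; .set x (.add (.reg x) (.const 1))) (s.setReg x 0) s' →
      Agree (.for x y p) s s' := by
    intro s' h
    have h1 : Agree (.for x y p) s (s.setReg x 0) :=
      Agree.weaken (Runs.agree (T := T) (.set x (.const 0) s)) (by simp [Prog.for, Prog.regs])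
        (by simp [Prog.arrs])
    exact h1.trans (h.weaken (by simp +contextual [Prog.for, Prog.regs])
      (by simp +contextual [Prog.for, Prog.arrs]))
  refine Halts.mono (Halts.while (B := B + 4)
    (fun m s' => ∃ i : ℕ, i + m = N ∧ s'.reg x = i ∧ s'.reg y = N ∧ I i s') ?_ N
    ⟨0, by simp, by simp [State.setReg], by simp [State.setReg, hxy, hN], h0⟩) (le_of_eq ?_) ?_
  · rintro m s' ha ⟨i, him, hi, hy', hIi⟩ hb
    simp only [Test.holds_lt, Expr.eval, hi, hy'] at hb
    refine ⟨m - 1, by omega, ?_⟩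
    refine Halts.seq (Halts.agree (hI i s' (by omega) (hag s' ha) hi hIi)) ?_
    rintro s'' ⟨h1, h2⟩
    have hx'' : s''.reg x = i := by rw [h2.1 x hx, hi]
    refine ⟨_, _, .set _ _ _, by simp [Expr.cost], i + 1, by omega, ?_, ?_, ?_⟩
    · simp [State.setReg, Expr.eval, hx'']
    · simp [State.setReg, hxy, h2.1 y hy, hy']
    · simpa [Expr.eval, hx''] using h1
  · simp only [Test.lt, Test.cost, Expr.cost]
    ring
  · rintro s' ⟨⟨m, i, him, hi, hy', hIi⟩, hb⟩
    simp only [Test.holds_lt, Expr.eval, hi, hy'] at hb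
    obtain rfl : i = N := by omega
    exact hIi

/-! ### Programs without loops -/

@[simp] theorem State.reg_setReg (s : State) (x : ℕ) (z : ℤ) :
    (s.setReg x z).reg = Function.update s.reg x z := rfl

@[simp] theorem State.arr_setReg (s : State) (x : ℕ) (z : ℤ) : (s.setReg x z).arr = s.arr := rfl

@[simp] theorem State.reg_setArr (s : State) (a : ℕ) (i z : ℤ) : (s.setArr a i z).reg = s.reg := rfl

@[simp] theorem State.arr_setArr (s : State) (a : ℕ) (i z : ℤ) :
    (s.setArr a i z).arr = Function.update s.arr a (Function.update (s.arr a) i z) := rfl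

/-- The weakest precondition of a program without loops. -/
def Prog.wp (T : TimeTable → ℤ → ℝ) : Prog → (State → Prop) → State → Prop
  | .skip, Q, s => Q s
  | .set x e, Q, s => Q (s.setReg x (e.eval s))
  | .put a i e, Q, s => Q (s.setArr a (i.eval s) (e.eval s))
  | .seq p q, Q, s => p.wp T (q.wp T Q) s
  | .ite b p q, Q, s => (b.Holds T s → p.wp T Q s) ∧ (¬ b.Holds T s → q.wp T Q s)
  | .while _ _, _, _ => False

/-- A bound for the running time of a program without loops. -/
def Prog.bound : Prog → ℕ
  | .skip => 1
  | .set _ e => e.cost + 1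
  | .put _ i e => i.cost + e.cost + 1
  | .seq p q => p.bound + q.bound
  | .ite b p q => b.cost + max p.bound q.bound + 1
  | .while _ _ => 0

/-- The value of `bound` on a loop does not matter, since `wp` is `False` there. For a concrete
program the bound is a closed numeral that `decide` can evaluate. -/
theorem Prog.wp.halts {T : TimeTable → ℤ → ℝ} {p : Prog} {Q : State → Prop} {s : State}
    (h : p.wp T Q s) : Halts T p s p.bound Q := by
  induction p generalizing Q s with
  | skip => exact ⟨_, _, .skip s, le_rfl, h⟩
  | set x e => exact ⟨_, _, .set x e s, le_rfl, h⟩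
  | put a i e => exact ⟨_, _, .put a i e s, le_rfl, h⟩
  | seq p q ihp ihq => exact (ihp h).seq fun s' hs' => ihq hs'
  | ite b p q ihp ihq =>
    exact Halts.ite (fun hb => (ihp (h.1 hb)).mono (le_max_left _ _) fun _ h => h)
      fun hb => (ihq (h.2 hb)).mono (le_max_right _ _) fun _ h => h
  | _ => exact h.elim

theorem Prog.wp.mono {T : TimeTable → ℤ → ℝ} {p : Prog} {Q Q' : State → Prop} {s : State}
    (h : p.wp T Q s) (hQ : ∀ s', Q s' → Q' s') : p.wp T Q' s := by
  induction p generalizing Q Q' s with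
  | skip => exact hQ _ h
  | set x e => exact hQ _ h
  | put a i e => exact hQ _ h
  | seq p q ihp ihq => exact ihp h fun s' hs' => ihq hs' hQ
  | ite b p q ihp ihq => exact ⟨fun hb => ihp (h.1 hb) hQ, fun hb => ihq (h.2 hb) hQ⟩
  | _ => exact h.elim

theorem Prog.wp.agree {T : TimeTable → ℤ → ℝ} {p : Prog} {Q : State → Prop} {s : State}
    (h : p.wp T Q s) : p.wp T (fun s' => Q s' ∧ Agree p s s') s := by
  induction p generalizing Q s with
  | skip => exact ⟨h, Agree.refl _ _⟩
  | set x e => exact ⟨h, Runs.agree (T := T) (.set x e s)⟩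
  | put a i e => exact ⟨h, Runs.agree (T := T) (.put a i e s)⟩
  | seq p q ihp ihq =>
    refine (ihp h).mono fun s₁ h₁ => (ihq h₁.1).mono fun s₂ h₂ => ⟨h₂.1, ?_⟩
    exact (h₁.2.weaken (by simp +contextual [Prog.regs]) (by simp +contextual [Prog.arrs])).trans
      (h₂.2.weaken (by simp +contextual [Prog.regs]) (by simp +contextual [Prog.arrs]))
  | ite b p q ihp ihq =>
    refine ⟨fun hb => (ihp (h.1 hb)).mono fun _ h' => ⟨h'.1, h'.2.weaken ?_ ?_⟩,
      fun hb => (ihq (h.2 hb)).mono fun _ h' => ⟨h'.1, h'.2.weaken ?_ ?_⟩⟩ <;>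
    simp +contextual [Prog.regs, Prog.arrs]
  | _ => exact h.elim

end TVSlots

namespace TVSlots

/-! ### The network of a set of intervals -/

/-- The `n` intervals `0, …, n - 1` have `2 n` distinct endpoints, the nodes `0, …, 2 n - 1`.
Interval `i` leads from node `start i` to node `finish i`, and `owner` maps a node to the interval
of which it is an endpoint; `k` is the number of sessions. -/
structure Net where
  n : ℤ
  k : ℤ
  start : ℤ → ℤ
  finish : ℤ → ℤ
  owner : ℤ → ℤ

/-- The properties that make a `Net` meaningful. -/
structure Net.Valid (G : Net) : Prop where
  start_nonneg : ∀ i, 0 ≤ i → i < G.n → 0 ≤ G.start i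
  start_lt_finish : ∀ i, 0 ≤ i → i < G.n → G.start i < G.finish i
  finish_lt : ∀ i, 0 ≤ i → i < G.n → G.finish i < 2 * G.n
  owner_start : ∀ i, 0 ≤ i → i < G.n → G.owner (G.start i) = i
  owner_finish : ∀ i, 0 ≤ i → i < G.n → G.owner (G.finish i) = i
  owner_spec : ∀ v, 0 ≤ v → v < 2 * G.n → 0 ≤ G.owner v ∧ G.owner v < G.n ∧
    (G.start (G.owner v) = v ∨ G.finish (G.owner v) = v)

/-- `load v` is the number of selected intervals that cover the gap between the nodes `v` and
`v + 1`, `price` is the dual solution, `weight i` the weight of interval `i`, and `sel i` is `1` if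
interval `i` is selected and `0` otherwise. -/
structure Flow where
  load : ℤ → ℤ
  price : ℤ → ℤ
  weight : ℤ → ℤ
  sel : ℤ → ℤ

namespace Net

variable (G : Net) (f : Flow)

/-- The price of an interval. -/
def cost (i : ℤ) : ℤ := f.price (G.finish i) - f.price (G.start i)

/-- The number of selected intervals that cover the gap after node `v`. -/
noncomputable def depth (x : ℤ → ℤ) (v : ℤ) : ℤ :=
  ∑ i ∈ Finset.Ico 0 G.n, if G.start i ≤ v ∧ v < G.finish i then x i else 0

/-- Complementary slackness for the interval `i`. -/
structure IntervalSlack (i : ℤ) : Prop where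
  sel_mem : f.sel i = 0 ∨ f.sel i = 1
  cost_le : f.sel i = 1 → G.cost f i ≤ f.weight i
  le_cost : f.sel i = 0 → f.weight i ≤ G.cost f i

/-- Complementary slackness for the gaps. -/
structure GapSlack : Prop where
  mono : ∀ v, 0 ≤ v → v + 1 < 2 * G.n → f.price v ≤ f.price (v + 1)
  load_le : ∀ v, 0 ≤ v → v + 1 < 2 * G.n → f.load v ≤ G.k
  tight : ∀ v, 0 ≤ v → v + 1 < 2 * G.n → f.price v = f.price (v + 1) ∨ f.load v = G.k

/-- The loads are correct except that one unit is missing on the way from node `a` to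
node `b`. -/
def Load (a b : ℤ) : Prop :=
  ∀ v, 0 ≤ v → v < 2 * G.n →
    f.load v + (if a ≤ v then 1 else 0) = G.depth f.sel v + if b ≤ v then 1 else 0

/-- A flow that is optimal for its weights. -/
structure Kilter : Prop where
  interval : ∀ i, 0 ≤ i → i < G.n → G.IntervalSlack f i
  gap : G.GapSlack f
  load : ∀ v, 0 ≤ v → v < 2 * G.n → f.load v = G.depth f.sel v

/-- There is a residual arc of reduced cost `0` and of type `y` into node `v`: type `1` reduces the
idle flow from `v` to `v + 1`, type `2` increases the idle flow from `v - 1` to `v`, and type `3`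
selects the interval that ends in `v` or deselects the interval that starts in `v`. -/
def Arc (y v : ℤ) : Prop :=
  0 ≤ v ∧ v < 2 * G.n ∧
    ((y = 1 ∧ v + 1 < 2 * G.n ∧ f.load v < G.k) ∨
      (y = 2 ∧ 1 ≤ v ∧ f.price (v - 1) = f.price v) ∨
      (y = 3 ∧ f.weight (G.owner v) = G.cost f (G.owner v) ∧
        (G.start (G.owner v) = v → f.sel (G.owner v) = 1) ∧
        (G.finish (G.owner v) = v → f.sel (G.owner v) = 0)))

/-- The other endpoint of the interval that has `v` as an endpoint. -/
def partner (v : ℤ) : ℤ :=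
  if G.start (G.owner v) = v then G.finish (G.owner v) else G.start (G.owner v)

/-- The tail of the arc of type `y` into `v`. -/
def tail (y v : ℤ) : ℤ :=
  if y = 1 then v + 1 else if y = 2 then v - 1 else G.partner v

variable {G f}

theorem Valid.partner_mem (hG : G.Valid) {v : ℤ} (h0 : 0 ≤ v) (h1 : v < 2 * G.n) :
    0 ≤ G.partner v ∧ G.partner v < 2 * G.n := by
  obtain ⟨ha, hb, -⟩ := hG.owner_spec v h0 h1
  have := hG.start_nonneg _ ha hb
  have := hG.start_lt_finish _ ha hb
  have := hG.finish_lt _ ha hb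
  unfold partner
  split_ifs <;> omega

theorem Valid.owner_partner (hG : G.Valid) {v : ℤ} (h0 : 0 ≤ v) (h1 : v < 2 * G.n) :
    G.owner (G.partner v) = G.owner v := by
  obtain ⟨ha, hb, -⟩ := hG.owner_spec v h0 h1
  unfold partner
  split_ifs
  · exact hG.owner_finish _ ha hb
  · exact hG.owner_start _ ha hb

theorem Valid.partner_partner (hG : G.Valid) {v : ℤ} (h0 : 0 ≤ v) (h1 : v < 2 * G.n) :
    G.partner (G.partner v) = v := by
  have ho := hG.owner_partner h0 h1
  obtain ⟨ha, hb, hc⟩ := hG.owner_spec v h0 h1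
  have := hG.start_lt_finish _ ha hb
  by_cases h : G.start (G.owner v) = v
  · have hp : G.partner v = G.finish (G.owner v) := if_pos h
    rw [partner, ho, hp, if_neg (by omega), h]
  · have hp : G.partner v = G.start (G.owner v) := if_neg h
    rw [partner, ho, hp, if_pos rfl]
    omega

theorem Arc.tail_mem (hG : G.Valid) {y v : ℤ} (h : G.Arc f y v) :
    0 ≤ G.tail y v ∧ G.tail y v < 2 * G.n := by
  obtain ⟨h0, h1, h⟩ := h
  have := hG.partner_mem h0 h1
  unfold tail
  split_ifs <;> omega

theorem tail_one (v : ℤ) : G.tail 1 v = v + 1 := if_pos rfl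

theorem tail_two (v : ℤ) : G.tail 2 v = v - 1 := by simp [tail]

theorem tail_three (v : ℤ) : G.tail 3 v = G.partner v := by simp [tail]

theorem Valid.partner_start (hG : G.Valid) {i : ℤ} (hi0 : 0 ≤ i) (hi1 : i < G.n) :
    G.partner (G.start i) = G.finish i := by
  simp [partner, hG.owner_start i hi0 hi1]

theorem Valid.partner_finish (hG : G.Valid) {i : ℤ} (hi0 : 0 ≤ i) (hi1 : i < G.n) :
    G.partner (G.finish i) = G.start i := by
  simp [partner, hG.owner_finish i hi0 hi1, (hG.start_lt_finish i hi0 hi1).ne]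

theorem arc_one {v : ℤ} (h0 : 0 ≤ v) (h1 : v + 1 < 2 * G.n) (h : f.load v < G.k) : G.Arc f 1 v :=
  ⟨h0, by omega, Or.inl ⟨rfl, h1, h⟩⟩

theorem arc_two {v : ℤ} (h0 : 1 ≤ v) (h1 : v < 2 * G.n) (h : f.price (v - 1) = f.price v) :
    G.Arc f 2 v :=
  ⟨by omega, h1, Or.inr (Or.inl ⟨rfl, h0, h⟩)⟩

theorem Valid.arc_start (hG : G.Valid) {i : ℤ} (hi0 : 0 ≤ i) (hi1 : i < G.n)
    (hw : f.weight i = G.cost f i) (hx : f.sel i = 1) : G.Arc f 3 (G.start i) := by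
  have h1 := hG.start_nonneg i hi0 hi1
  have h2 := hG.start_lt_finish i hi0 hi1
  have h3 := hG.finish_lt i hi0 hi1
  refine ⟨h1, by omega, Or.inr (Or.inr ⟨rfl, ?_⟩)⟩
  rw [hG.owner_start i hi0 hi1]
  exact ⟨hw, fun _ => hx, fun h => by omega⟩

theorem Valid.arc_finish (hG : G.Valid) {i : ℤ} (hi0 : 0 ≤ i) (hi1 : i < G.n)
    (hw : f.weight i = G.cost f i) (hx : f.sel i = 0) : G.Arc f 3 (G.finish i) := by
  have h1 := hG.start_nonneg i hi0 hi1
  have h2 := hG.start_lt_finish i hi0 hi1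
  have h3 := hG.finish_lt i hi0 hi1
  refine ⟨by omega, h3, Or.inr (Or.inr ⟨rfl, ?_⟩)⟩
  rw [hG.owner_finish i hi0 hi1]
  exact ⟨hw, fun h => by omega, fun _ => hx⟩

/-! ### Searching the residual network -/

/-- The state of a breadth-first search from node `r`.  The queue `que` holds the `l` nodes found so
far, `ord v` is the position of node `v` in the queue plus one, or `0` if `v` has not been found,
and `typ v` is the type of the arc by which `v` was found.  The first `h` nodes of the queue have
been processed, and the arcs out of `u` of types up to `y` as well. -/
structure Search (G : Net) (f : Flow) (r : ℤ) (ord typ que : ℤ → ℤ) (l h u y : ℤ) : Prop where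
  queue : ∀ m, 0 ≤ m → m < l → 0 ≤ que m ∧ que m < 2 * G.n ∧ ord (que m) = m + 1
  found : ∀ v, 0 ≤ v → v < 2 * G.n → ord v ≠ 0 → 0 < ord v ∧ ord v ≤ l ∧ que (ord v - 1) = v ∧
    (v = r ∨ G.Arc f (typ v) v ∧ 0 < ord (G.tail (typ v) v) ∧ ord (G.tail (typ v) v) < ord v)
  root : ord r ≠ 0
  nonneg : 0 ≤ h
  le : h ≤ l
  closed : ∀ z v, G.Arc f z v → ord (G.tail z v) ≠ 0 →
    (ord (G.tail z v) ≤ h ∨ (G.tail z v = u ∧ z ≤ y)) → ord v ≠ 0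

namespace Search

variable {r l h u y : ℤ} {ord typ que : ℤ → ℤ}

theorem init (hr0 : 0 ≤ r) (hr1 : r < 2 * G.n) (h0 : ∀ v, 0 ≤ v → v < 2 * G.n → ord v = 0)
    (hG : G.Valid) :
    Search G f r (Function.update ord r 1) typ (Function.update que 0 r) 1 0 u 0 where
  queue m hm0 hm1 := by
    obtain rfl : m = 0 := by omega
    simp [hr0, hr1]
  found v hv0 hv1 hv := by
    by_cases hvr : v = r
    · subst hvr
      simp
    · simp [hvr, h0 v hv0 hv1] at hv
  root := by simp
  nonneg := le_rfl
  le := by norm_num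
  -- Vacuous at the start: no position is at most `0`, and every arc type is at least `1`.
  closed z v ha h1 h2 := by
    have hm := ha.tail_mem hG
    have hz : 1 ≤ z := by
      rcases ha.2.2 with h | h | h <;> omega
    by_cases hvr : G.tail z v = r
    · rw [hvr] at h2
      simp at h2
      omega
    · simp [hvr, h0 _ hm.1 hm.2] at h1

/-- The queue holds at most `2 n` nodes. -/
theorem length_le (hn : 0 ≤ G.n) (H : Search G f r ord typ que l h u y) : l ≤ 2 * G.n := by
  -- `ord` inverts `que` up to a shift by one, so the queue never repeats a node.
  have hinj : Set.InjOn que (Finset.Ico 0 l : Finset ℤ) := by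
    intro a ha b hb hab
    simp only [Finset.coe_Ico, Set.mem_Ico] at ha hb
    have h1 := (H.queue a ha.1 ha.2).2.2
    have h2 := (H.queue b hb.1 hb.2).2.2
    rw [hab] at h1
    omega
  have hmaps : ∀ a ∈ Finset.Ico 0 l, que a ∈ Finset.Ico 0 (2 * G.n) := by
    intro a ha
    simp only [Finset.mem_Ico] at ha ⊢
    have := H.queue a ha.1 ha.2
    omega
  have := Finset.card_le_card_of_injOn que hmaps hinj
  simp only [Int.card_Ico, sub_zero] at this
  omega

/-- A node is found. -/
theorem visit (hG : G.Valid) (H : Search G f r ord typ que l h u y) {z v : ℤ}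
    (hv : ord v = 0) (hu : ord u ≠ 0) (ha : G.Arc f z v) (ht0 : 0 < ord (G.tail z v)) :
    Search G f r (Function.update ord v (l + 1)) (Function.update typ v z)
      (Function.update que l v) (l + 1) h u y where
  queue m hm0 hm1 := by
    by_cases hml : m = l
    · subst hml
      simp [ha.1, ha.2.1]
    · have := H.queue m hm0 (by omega)
      have hne : que m ≠ v := by
        rintro rfl
        omega
      simp [hml, hne, this]
  found w hw0 hw1 hw := by
    have hl : 0 ≤ l := H.nonneg.trans H.le
    by_cases hwv : w = v
    · subst hwv
      have htw : G.tail z w ≠ w := by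
        intro h'
        rw [h'] at ht0
        omega
      have hm := ha.tail_mem hG
      have := H.found _ hm.1 hm.2 ht0.ne'
      simp [htw]
      exact ⟨by omega, Or.inr ⟨ha, by omega, by omega⟩⟩
    · simp only [Function.update_apply, hwv, if_false] at hw ⊢
      obtain ⟨h1, h2, h3, h4⟩ := H.found w hw0 hw1 hw
      refine ⟨h1, by omega, by rw [if_neg (by omega), h3], h4.imp_right ?_⟩
      rintro ⟨h5, h6, h7⟩
      have : G.tail (typ w) w ≠ v := by
        intro h'
        rw [h'] at h6
        omega
      simp [this, h5, h6, h7]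
  root := by
    have hl : 0 ≤ l := H.nonneg.trans H.le
    by_cases h' : r = v
    · simp [h']
      omega
    · simp [h', H.root]
  nonneg := H.nonneg
  le := by have := H.le; omega
  -- The new node has position `l + 1 > h` and differs from `u`, so the arcs leaving it impose
  -- nothing yet.
  closed z' v' ha' h1 h2 := by
    have hl : 0 ≤ l := H.nonneg.trans H.le
    have hlh := H.le
    by_cases hv' : v' = v
    · simp [hv']
      omega
    · simp only [Function.update_apply, hv', if_false] at h1 h2 ⊢
      refine H.closed z' v' ha' ?_ ?_ <;> by_cases htv : G.tail z' v' = v <;>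
        simp only [htv, if_true, if_false] at h1 h2 ⊢
      · rcases h2 with h2 | ⟨rfl, -⟩
        · omega
        · exact hu
      · exact h1
      · rcases h2 with h2 | ⟨rfl, -⟩
        · omega
        · exact absurd hv hu
      · exact h2

/-- All arcs of type `y` out of the current node have been processed. -/
theorem advance (H : Search G f r ord typ que l h u y)
    (hy : ∀ v, G.Arc f (y + 1) v → G.tail (y + 1) v = u → ord v ≠ 0) :
    Search G f r ord typ que l h u (y + 1) :=
  { H with
    closed := fun z v ha h1 h2 => by
      by_cases hz : z = y + 1 ∧ G.tail z v = u
      · obtain ⟨rfl, h'⟩ := hz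
        exact hy v ha h'
      · refine H.closed z v ha h1 (h2.imp_right fun h' => ⟨h'.1, ?_⟩)
        have := h'.2
        have : z ≠ y + 1 := fun h'' => hz ⟨h'', h'.1⟩
        omega }

/-- A node of the queue is taken up. -/
theorem take (H : Search G f r ord typ que l h u 0) (u' : ℤ) :
    Search G f r ord typ que l h u' 0 :=
  { H with
    closed := fun z v ha h1 h2 => by
      have hz : 1 ≤ z := by
        rcases ha.2.2 with h | h | h <;> omega
      exact H.closed z v ha h1 (Or.inl (by omega)) }

/-- The current node has been processed. -/
theorem next (hG : G.Valid) (H : Search G f r ord typ que l h u 3) (hu : que h = u)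
    (hhl : h < l) : Search G f r ord typ que l (h + 1) u 0 :=
  { H with
    nonneg := by have := H.nonneg; omega
    le := hhl
    closed := fun z v ha h1 h2 => by
      have hz : 1 ≤ z ∧ z ≤ 3 := by
        rcases ha.2.2 with h | h | h <;> omega
      have hm := ha.tail_mem hG
      refine H.closed z v ha h1 ?_
      by_cases h3 : ord (G.tail z v) ≤ h
      · exact Or.inl h3
      -- The only found node in position `h + 1` is `que h`, the node just processed.
      · have h4 : ord (G.tail z v) - 1 = h := by omega
        have h5 := (H.found _ hm.1 hm.2 h1).2.2.1
        rw [h4, hu] at h5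
        exact Or.inr ⟨h5.symm, hz.2⟩ }

/-- A search has terminated. -/
theorem closed_of_eq (hG : G.Valid) (H : Search G f r ord typ que l l u y) {z v : ℤ}
    (ha : G.Arc f z v) (h1 : ord (G.tail z v) ≠ 0) : ord v ≠ 0 :=
  have hm := ha.tail_mem hG
  H.closed z v ha h1 (Or.inl (H.found _ hm.1 hm.2 h1).2.1)

end Search

/-! ### Changing the prices -/

/-- If the search from the end of interval `j`, whose weight exceeds its price by one, does not find
the start of `j`, then raising the prices of all found nodes by one restores optimality. -/
theorem Kilter.raise (hG : G.Valid) {ord price : ℤ → ℤ} {j : ℤ} (hj0 : 0 ≤ j) (hj1 : j < G.n)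
    (hint : ∀ i, 0 ≤ i → i < G.n → i ≠ j → G.IntervalSlack f i) (hgap : G.GapSlack f)
    (hload : ∀ v, 0 ≤ v → v < 2 * G.n → f.load v = G.depth f.sel v)
    (hsel : f.sel j = 0) (hw : f.weight j = G.cost f j + 1)
    (hroot : ord (G.finish j) ≠ 0) (hstart : ord (G.start j) = 0)
    (hclosed : ∀ z v, G.Arc f z v → ord (G.tail z v) ≠ 0 → ord v ≠ 0)
    (hprice : ∀ v, 0 ≤ v → v < 2 * G.n → price v = f.price v + if ord v = 0 then 0 else 1) :
    G.Kilter { f with price := price } where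
  interval i hi0 hi1 := by
    have hs := hG.start_nonneg i hi0 hi1
    have hsf := hG.start_lt_finish i hi0 hi1
    have hf := hG.finish_lt i hi0 hi1
    have hp1 := hprice (G.start i) hs (by omega)
    have hp2 := hprice (G.finish i) (by omega) hf
    by_cases hij : i = j
    · subst hij
      -- The end of `j` rises and its start does not, so the cost of `j` grows by one and meets its
      -- weight.
      rw [if_pos hstart] at hp1
      rw [if_neg hroot] at hp2
      refine ⟨Or.inl hsel, fun h => ?_, fun _ => ?_⟩
      · simp only at h
        omega
      · simp only [cost] at hw ⊢
        omega
    · obtain ⟨h1, h2, h3⟩ := hint i hi0 hi1 hij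
      refine ⟨h1, fun h => ?_, fun h => ?_⟩
      · have h2 := h2 h
        -- The cost rises only if the end is found and the start is not. Closedness excludes this
        -- when weight and cost agree; otherwise the integers differ by at least one, which leaves
        -- room.
        have ha : f.weight i = G.cost f i → ord (G.finish i) ≠ 0 → ord (G.start i) ≠ 0 :=
          fun hw ho => hclosed 3 _ (hG.arc_start hi0 hi1 hw h)
            (by rwa [tail_three, hG.partner_start hi0 hi1])
        simp only [cost] at h2 ha ⊢
        split_ifs at hp1 hp2 <;> omega
      · have h3 := h3 h
        have ha : f.weight i = G.cost f i → ord (G.start i) ≠ 0 → ord (G.finish i) ≠ 0 :=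
          fun hw ho => hclosed 3 _ (hG.arc_finish hi0 hi1 hw h)
            (by rwa [tail_three, hG.partner_finish hi0 hi1])
        simp only [cost] at h3 ha ⊢
        split_ifs at hp1 hp2 <;> omega
  gap := by
    -- Across a gap that is not full the prices agree and both arcs are residual, so its two nodes
    -- are found together. Across a full gap only monotonicity is at stake, and the type `2` arc
    -- protects it when the prices agree.
    have h1 : ∀ v, 0 ≤ v → v + 1 < 2 * G.n → f.load v < G.k → ord (v + 1) ≠ 0 → ord v ≠ 0 :=
      fun v h0 h1 hl ho => hclosed 1 v (arc_one h0 h1 hl) (by rwa [tail_one])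
    have h2 : ∀ v, 0 ≤ v → v + 1 < 2 * G.n → f.price v = f.price (v + 1) → ord v ≠ 0 →
        ord (v + 1) ≠ 0 :=
      fun v h0 h1 hl ho => hclosed 2 (v + 1) (arc_two (by omega) h1 (by simpa using hl))
        (by simpa [tail_two] using ho)
    refine ⟨fun v h0 hv => ?_, hgap.load_le, fun v h0 hv => ?_⟩ <;>
    · have hp1 := hprice v h0 (by omega)
      have hp2 := hprice (v + 1) (by omega) hv
      have hm := hgap.mono v h0 hv
      have hl := hgap.load_le v h0 hv
      have ht := hgap.tight v h0 hv
      have ha := h1 v h0 hv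
      have hb := h2 v h0 hv
      simp only
      split_ifs at hp1 hp2 <;> omega
  load := hload

/-! ### Changing the selection -/

/-- The state while the flow is changed along the path found by a search with root `r`, from its
end back to node `c`. -/
structure Walk (G : Net) (f : Flow) (r : ℤ) (ord typ : ℤ → ℤ) (c : ℤ) : Prop where
  interval : ∀ i, 0 ≤ i → i < G.n → G.IntervalSlack f i
  gap : G.GapSlack f
  load : G.Load f c r
  nonneg : 0 ≤ c
  lt : c < 2 * G.n
  pos : 0 < ord c
  path : ∀ v, 0 ≤ v → v < 2 * G.n → ord v ≠ 0 → 0 < ord v ∧ (ord v ≤ ord c → v = r ∨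
    G.Arc f (typ v) v ∧ 0 < ord (G.tail (typ v) v) ∧ ord (G.tail (typ v) v) < ord v)

theorem depth_update (x : ℤ → ℤ) {i : ℤ} (hi0 : 0 ≤ i) (hi1 : i < G.n) (z v : ℤ) :
    G.depth (Function.update x i z) v =
      G.depth x v + if G.start i ≤ v ∧ v < G.finish i then z - x i else 0 := by
  have hi : i ∈ Finset.Ico 0 G.n := by simp [hi0, hi1]
  unfold depth
  rw [← Finset.add_sum_erase _ _ hi, ← Finset.add_sum_erase _ _ hi]
  have : ∀ j ∈ (Finset.Ico 0 G.n).erase i,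
      (if G.start j ≤ v ∧ v < G.finish j then Function.update x i z j else 0) =
        if G.start j ≤ v ∧ v < G.finish j then x j else 0 := by
    intro j hj
    rw [Function.update_of_ne (Finset.ne_of_mem_erase hj)]
  rw [Finset.sum_congr rfl this, Function.update_self]
  split_ifs <;> ring

theorem IntervalSlack.congr {f' : Flow} {i : ℤ} (H : G.IntervalSlack f i)
    (hp : f'.price = f.price) (hw : f'.weight = f.weight) (hx : f'.sel i = f.sel i) :
    G.IntervalSlack f' i := by
  obtain ⟨h1, h2, h3⟩ := H
  simp only [cost] at h2 h3
  constructor <;> simpa only [cost, hp, hw, hx]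

namespace Walk

variable {r c : ℤ} {ord typ : ℤ → ℤ}

/-- The walk starts: the interval `j` is selected. -/
theorem init (hG : G.Valid) {j : ℤ} (hj0 : 0 ≤ j) (hj1 : j < G.n)
    (hint : ∀ i, 0 ≤ i → i < G.n → i ≠ j → G.IntervalSlack f i) (hgap : G.GapSlack f)
    (hload : ∀ v, 0 ≤ v → v < 2 * G.n → f.load v = G.depth f.sel v)
    (hsel : f.sel j = 0) (hw : f.weight j = G.cost f j + 1) {que : ℤ → ℤ} {l h u y : ℤ}
    (H : Search G f (G.finish j) ord typ que l h u y) (hord : ord (G.start j) ≠ 0) :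
    Walk G { f with sel := Function.update f.sel j 1 } (G.finish j) ord typ (G.start j) where
  interval i hi0 hi1 := by
    by_cases hij : i = j
    · subst hij
      refine ⟨by simp, fun _ => ?_, fun h => by simp at h⟩
      simp only [cost] at hw ⊢
      omega
    · obtain ⟨h1, h2, h3⟩ := hint i hi0 hi1 hij
      exact ⟨by simpa [hij] using h1, by simpa [hij, cost] using h2, by simpa [hij, cost] using h3⟩
  gap := ⟨hgap.mono, hgap.load_le, hgap.tight⟩
  load v hv0 hv1 := by
    have := hG.start_lt_finish j hj0 hj1
    simp only [depth_update f.sel hj0 hj1, hload v hv0 hv1, hsel]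
    split_ifs <;> omega
  nonneg := hG.start_nonneg j hj0 hj1
  lt := (hG.start_lt_finish j hj0 hj1).trans (hG.finish_lt j hj0 hj1)
  pos := by
    have h1 := hG.start_nonneg j hj0 hj1
    have h2 := hG.start_lt_finish j hj0 hj1
    have h3 := hG.finish_lt j hj0 hj1
    exact (H.found _ h1 (by omega) hord).1
  path v hv0 hv1 hv := by
    obtain ⟨h1, -, -, h2⟩ := H.found v hv0 hv1 hv
    refine ⟨h1, fun _ => h2.imp_right fun h3 => ⟨?_, h3.2⟩⟩
    obtain ⟨ha, hb, hc⟩ := h3.1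
    refine ⟨ha, hb, hc.imp_right (Or.imp_right fun h4 => ⟨h4.1, h4.2.1, ?_⟩)⟩
    -- The weight of `j` differs from its cost, so no type `3` arc of the search belongs to `j`, and
    -- selecting `j` leaves the path valid.
    have : G.owner v ≠ j := by
      intro h'
      have := h4.2.1
      rw [h'] at this
      omega
    simpa [this] using h4.2.2

theorem arc (H : Walk G f r ord typ c) (hc : c ≠ r) :
    G.Arc f (typ c) c ∧ 0 < ord (G.tail (typ c) c) ∧ ord (G.tail (typ c) c) < ord c :=
  ((H.path c H.nonneg H.lt H.pos.ne').2 le_rfl).resolve_left hc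

/-- When the walk is back at the root, the two corrections in `Load` cancel. -/
theorem kilter (H : Walk G f r ord typ r) : G.Kilter f :=
  ⟨H.interval, H.gap, fun v h0 h1 => by
    have := H.load v h0 h1
    omega⟩

/-- One step of the walk, provided that the changed flow `f'` has the stated properties. -/
theorem step (hG : G.Valid) (H : Walk G f r ord typ c) (hc : c ≠ r) {f' : Flow}
    (hint : ∀ i, 0 ≤ i → i < G.n → G.IntervalSlack f' i) (hgap : G.GapSlack f')
    (hload : G.Load f' (G.tail (typ c) c) r)
    (harc : ∀ v, v ≠ c → (typ v = 3 → v ≠ G.partner c) → G.Arc f (typ v) v → G.Arc f' (typ v) v) :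
    Walk G f' r ord typ (G.tail (typ c) c) where
  interval := hint
  gap := hgap
  load := hload
  nonneg := ((H.arc hc).1.tail_mem hG).1
  lt := ((H.arc hc).1.tail_mem hG).2
  pos := (H.arc hc).2.1
  path v hv0 hv1 hv := by
    obtain ⟨h1, h2⟩ := H.path v hv0 hv1 hv
    obtain ⟨h3, h4, h5⟩ := H.arc hc
    -- Positions decrease strictly along the walk, so only arcs into nodes found before `c` must
    -- survive. If `partner c` had been found by a type `3` arc, that arc would come from `c`, and
    -- `partner c` would have been found after `c`.
    refine ⟨h1, fun h => (h2 (by omega)).imp_right fun h6 => ⟨harc v ?_ ?_ h6.1, h6.2⟩⟩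
    · rintro rfl
      omega
    · rintro h7 rfl
      have h8 := h6.2.2
      rw [tail, h7, if_neg (by norm_num), if_neg (by norm_num),
        hG.partner_partner H.nonneg H.lt] at h8
      omega

/-- An arc of type `1`. -/
theorem step_one (hG : G.Valid) (H : Walk G f r ord typ c) (hc : c ≠ r) (ht : typ c = 1) :
    Walk G { f with load := Function.update f.load c (f.load c + 1) } r ord typ (c + 1) := by
  have ha := (H.arc hc).1
  rw [ht] at ha
  obtain ⟨h0, h1, h2⟩ := ha
  have h2 : c + 1 < 2 * G.n ∧ f.load c < G.k := by omega
  have := H.step hG hc (f' := { f with load := Function.update f.load c (f.load c + 1) })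
    (fun i h0 h1 => (H.interval i h0 h1).congr rfl rfl rfl) ⟨H.gap.mono, fun v h3 h4 => ?_,
      fun v h3 h4 => ?_⟩ (fun v h3 h4 => ?_) (fun v hv _ => ?_)
  · rwa [ht, tail_one] at this
  · have := H.gap.load_le v h3 h4
    simp only [Function.update_apply]
    split_ifs with h5
    · omega
    · exact this
  · have := H.gap.tight v h3 h4
    simp only [Function.update_apply]
    split_ifs with h5
    · subst h5
      -- The gap was not full before the change, so its two prices were already equal.
      exact Or.inl (this.resolve_right (by omega))
    · exact this
  · have := H.load v h3 h4
    simp only [ht, tail_one, Function.update_apply]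
    split_ifs at this ⊢ <;> subst_vars <;> omega
  -- The load of the gap after `c` matters only to the type `1` arc into `c`.
  · simp [Arc, hv, cost]

/-- An arc of type `2`. -/
theorem step_two (hG : G.Valid) (H : Walk G f r ord typ c) (hc : c ≠ r) (ht : typ c = 2) :
    Walk G { f with load := Function.update f.load (c - 1) (f.load (c - 1) - 1) } r ord typ
      (c - 1) := by
  have ha := (H.arc hc).1
  rw [ht] at ha
  obtain ⟨h0, h1, h2⟩ := ha
  -- Equal prices allow the load to drop below `k`. No lower bound on loads is needed, as they equal
  -- depths again at the end of the walk.
  have h2 : 1 ≤ c ∧ f.price (c - 1) = f.price c := by omega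
  have := H.step hG hc
    (f' := { f with load := Function.update f.load (c - 1) (f.load (c - 1) - 1) })
    (fun i h0 h1 => (H.interval i h0 h1).congr rfl rfl rfl) ⟨H.gap.mono, fun v h3 h4 => ?_,
      fun v h3 h4 => ?_⟩ (fun v h3 h4 => ?_) (fun v hv _ => ?_)
  · rwa [ht, tail_two] at this
  · have := H.gap.load_le v h3 h4
    simp only [Function.update_apply]
    split_ifs with h5
    · subst h5
      omega
    · exact this
  · have := H.gap.tight v h3 h4
    simp only [Function.update_apply]
    split_ifs with h5
    · subst h5
      simp [h2.2]
    · exact this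
  · have := H.load v h3 h4
    simp only [ht, tail_two, Function.update_apply]
    split_ifs at this ⊢ <;> subst_vars <;> omega
  · rintro ⟨h3, h4, h5⟩
    refine ⟨h3, h4, h5.imp_left fun h6 => ⟨h6.1, h6.2.1, ?_⟩⟩
    simp only [Function.update_apply]
    split_ifs with h7
    · subst h7
      omega
    · exact h6.2.2

/-- An arc of type `3`. -/
theorem step_three (hG : G.Valid) (H : Walk G f r ord typ c) (hc : c ≠ r) (h1 : typ c ≠ 1)
    (h2 : typ c ≠ 2) :
    Walk G { f with
      sel := Function.update f.sel (G.owner c) (if G.start (G.owner c) = c then 0 else 1) } r ord typ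
      (G.partner c) := by
  obtain ⟨hi0, hi1, hi2⟩ := hG.owner_spec c H.nonneg H.lt
  have hsf := hG.start_lt_finish _ hi0 hi1
  have ha := (H.arc hc).1.2.2
  have ht : typ c = 3 := by omega
  have hw : f.weight (G.owner c) = G.cost f (G.owner c) := by omega
  have hx : f.sel (G.owner c) = if G.start (G.owner c) = c then 1 else 0 := by
    split_ifs <;> omega
  have := H.step hG hc (f' := { f with
      sel := Function.update f.sel (G.owner c) (if G.start (G.owner c) = c then 0 else 1) }) (fun i h0 h1 => ?_)
      ⟨H.gap.mono, H.gap.load_le, H.gap.tight⟩ (fun v h3 h4 => ?_) (fun v hv hv' => ?_)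
  · rwa [ht, tail_three] at this
  · by_cases hi : i = G.owner c
    · subst hi
      -- Weight equals cost here, so slackness holds whether or not the interval is selected.
      refine ⟨?_, fun _ => hw.ge, fun _ => hw.le⟩
      simp only [Function.update_self]
      split_ifs <;> simp
    · exact (H.interval i h0 h1).congr rfl rfl (by simp [hi])
  · have := H.load v h3 h4
    simp only [ht, tail_three, depth_update _ hi0 hi1, hx, partner]
    split_ifs at this ⊢ <;> omega
  · rintro ⟨h3, h4, h5⟩
    refine ⟨h3, h4, h5.imp_right (Or.imp_right fun h6 => ⟨h6.1, h6.2.1, ?_⟩)⟩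
    -- The flip affects only the type `3` arcs into the two endpoints of the interval, and both are
    -- excluded.
    have hne : G.owner v ≠ G.owner c := by
      intro h
      obtain ⟨-, -, h7⟩ := hG.owner_spec v h3 h4
      have := hv' h6.1
      rw [partner] at this
      rw [h] at h7
      split_ifs at this <;> omega
    simpa [hne] using h6.2.2

end Walk

end Net

end TVSlots

namespace TVSlots

/-! ### Searching the residual network by a program

Registers: `0` the number `n` of programmes, `1` the number `k` of sessions, `2` the number `2 n` of
nodes, `3` the current programme, `4` its current weight, `5` its number of viewers, `6` a node,
`7` and `8` the numbers of processed and of found nodes, `9` the node that is processed, `10` a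
programme.

Arrays: `0` the numbers of viewers, `1` the sessions, `2`, `3` and `4` the starts, finishes and
owners of the net, `5`, `6`, `7` and `8` the loads, prices, weights and selection of the flow, `9`,
`10` and `11` the positions, types and queue of the search, `12` a stack of free sessions. -/

/-- The memory `s` holds the network `G`. -/
structure State.HasNet (s : State) (G : Net) : Prop where
  n : s.reg 0 = G.n
  k : s.reg 1 = G.k
  nodes : s.reg 2 = 2 * G.n
  start : s.arr 2 = G.start
  finish : s.arr 3 = G.finish
  owner : s.arr 4 = G.owner

/-- The flow that the memory holds. -/
def State.flow (s : State) : Flow := ⟨s.arr 5, s.arr 6, s.arr 7, s.arr 8⟩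

theorem Agree.hasNet {p : Prog} {s s' : State} {G : Net} (h : Agree p s s') (H : s.HasNet G)
    (hr : ∀ x ≤ 2, x ∉ p.regs := by decide) (ha : ∀ a, 2 ≤ a → a ≤ 4 → a ∉ p.arrs := by decide) :
    s'.HasNet G where
  n := by rw [h.1 0 (hr 0 (by norm_num)), H.n]
  k := by rw [h.1 1 (hr 1 (by norm_num)), H.k]
  nodes := by rw [h.1 2 (hr 2 (by norm_num)), H.nodes]
  start := by rw [h.2 2 (ha 2 (by norm_num) (by norm_num)), H.start]
  finish := by rw [h.2 3 (ha 3 (by norm_num) (by norm_num)), H.finish]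
  owner := by rw [h.2 4 (ha 4 (by norm_num) (by norm_num)), H.owner]

theorem Agree.flow {p : Prog} {s s' : State} (h : Agree p s s')
    (ha : ∀ a, 5 ≤ a → a ≤ 8 → a ∉ p.arrs := by decide) : s'.flow = s.flow := by
  simp [State.flow, h.2 5 (ha 5 (by norm_num) (by norm_num)),
    h.2 6 (ha 6 (by norm_num) (by norm_num)), h.2 7 (ha 7 (by norm_num) (by norm_num)),
    h.2 8 (ha 8 (by norm_num) (by norm_num))]

/-- The memory holds a search that is processing node `s.reg 9`. -/
structure State.Searching (G : Net) (f : Flow) (r y : ℤ) (s : State) : Prop where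
  net : s.HasNet G
  flow : s.flow = f
  search : Net.Search G f r (s.arr 9) (s.arr 10) (s.arr 11) (s.reg 8) (s.reg 7) (s.reg 9) y
  current : s.arr 11 (s.reg 7) = s.reg 9
  lt : s.reg 7 < s.reg 8

/-- Append node `e`, found by an arc of type `z`, to the queue. -/
def visit (e : Expr) (z : ℤ) : Prog :=
  .put 11 (.reg 8) e ;; .put 10 e (.const z) ;; .set 8 (.add (.reg 8) (.const 1)) ;;
    .put 9 e (.reg 8)

/-- Test whether node `e` has not been found. -/
def unseen (e : Expr) : Test := .eq (.get 9 e) (.const 0)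

/-- Test whether the weight of programme `s.reg 10` equals its price. -/
def tight : Test :=
  .eq (.get 7 (.reg 10)) (.sub (.get 6 (.get 3 (.reg 10))) (.get 6 (.get 2 (.reg 10))))

/-- Visit node `e` if it has not been found and `b` holds. -/
def tryVisit (b : Test) (e : Expr) (z : ℤ) : Prog := .ite (.and b (unseen e)) (visit e z) .skip

variable {T : TimeTable → ℤ → ℝ} {G : Net} {f : Flow} {r y : ℤ} {s : State}

/-- The node `e` is the only possible head of an arc of type `y + 1` out of the current node, and
`b` tests whether that arc exists. Hypothesis `he` is needed because `visit` evaluates `e` again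
after having written to arrays and to register `8`. -/
theorem tryVisit_wp (hG : G.Valid) (hs : s.Searching G f r y) {b : Test} {e : Expr} {v : ℤ}
    (he : ∀ s' : State, (∀ x ≠ 8, s'.reg x = s.reg x) → (∀ a ≤ 8, s'.arr a = s.arr a) →
      e.eval s' = v)
    (h1 : b.Holds T s → G.Arc f (y + 1) v ∧ G.tail (y + 1) v = s.reg 9)
    (h2 : ∀ w, G.Arc f (y + 1) w → G.tail (y + 1) w = s.reg 9 → w = v ∧ b.Holds T s) :
    (tryVisit b e (y + 1)).wp T (State.Searching G f r (y + 1)) s := by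
  obtain ⟨hn, hf, hS, hc, hl⟩ := hs
  have h7 : 0 ≤ s.reg 7 := hS.nonneg
  have hq := hS.queue _ h7 hl
  rw [hc] at hq
  have e0 := he s (fun _ _ => rfl) fun _ _ => rfl
  refine ⟨fun ⟨hb, hu⟩ => ?_, fun hb => ⟨hn, hf, hS.advance ?_, hc, hl⟩⟩
  · simp only [unseen, Test.holds_eq, Expr.eval, e0] at hu
    obtain ⟨ha, ht⟩ := h1 hb
    have hv := hS.visit hG hu (by omega) ha (by rw [ht]; omega)
    have e1 : e.eval (s.setArr 11 (s.reg 8) v) = v := by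
      refine he _ (fun x hx => rfl) fun a ha => ?_
      simp [show a ≠ 11 by omega]
    have e2 : e.eval (((s.setArr 11 (s.reg 8) v).setArr 10 v (y + 1)).setReg 8 (s.reg 8 + 1)) =
        v := by
      refine he _ (fun x hx => ?_) fun a ha => ?_
      · simp [hx]
      · simp [show a ≠ 11 by omega, show a ≠ 10 by omega]
    simp only [visit, Prog.wp, Expr.eval, e0, e1, State.reg_setArr, e2]
    refine ⟨⟨hn.n, hn.k, hn.nodes, hn.start, hn.finish, hn.owner⟩, hf, ?_, ?_, ?_⟩
    · refine Net.Search.advance (by simpa using hv) ?_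
      intro w hw1 hw2
      obtain ⟨rfl, -⟩ := h2 w hw1 (by simpa using hw2)
      simp
      omega
    · simp [hl.ne, hc]
    · simp
      omega
  · intro w hw1 hw2 hw3
    obtain ⟨rfl, hb'⟩ := h2 w hw1 hw2
    exact hb ⟨hb', by simp [unseen, Expr.eval, e0, hw3]⟩

/-- Process the arc from node `s.reg 9` to the previous node. -/
def scanLeft : Prog :=
  tryVisit (.and (.le (.const 1) (.reg 9)) (.lt (.get 5 (.sub (.reg 9) (.const 1))) (.reg 1)))
    (.sub (.reg 9) (.const 1)) 1

/-- Process the arc from node `s.reg 9` to the next node. -/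
def scanRight : Prog :=
  tryVisit (.and (.lt (.add (.reg 9) (.const 1)) (.reg 2))
    (.eq (.get 6 (.reg 9)) (.get 6 (.add (.reg 9) (.const 1))))) (.add (.reg 9) (.const 1)) 2

/-- Process the arc from node `s.reg 9` to the other endpoint of its programme. -/
def scanPartner : Prog :=
  .set 10 (.get 4 (.reg 9)) ;;
    .ite (.eq (.get 2 (.reg 10)) (.reg 9))
      (tryVisit (.and tight (.eq (.get 8 (.reg 10)) (.const 0))) (.get 3 (.reg 10)) 3)
      (tryVisit (.and tight (.eq (.get 8 (.reg 10)) (.const 1))) (.get 2 (.reg 10)) 3)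

theorem State.Searching.mem (hs : s.Searching G f r y) : 0 ≤ s.reg 9 ∧ s.reg 9 < 2 * G.n := by
  have := hs.search.queue _ hs.search.nonneg hs.lt
  rw [hs.current] at this
  exact ⟨this.1, this.2.1⟩

theorem scanLeft_wp (hG : G.Valid) (hs : s.Searching G f r 0) :
    scanLeft.wp T (State.Searching G f r 1) s := by
  have hm := hs.mem
  have hl : s.arr 5 = f.load := by rw [← hs.flow]; rfl
  have hk := hs.net.k
  refine tryVisit_wp hG hs (y := 0) (v := s.reg 9 - 1) ?_ ?_ ?_
  · intro s' h1 h2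
    simp [Expr.eval, h1]
  · simp only [Test.Holds, Test.holds_lt, Expr.eval, hl, hk]
    rintro ⟨h1, h2⟩
    exact ⟨Net.arc_one (by omega) (by omega) h2, by rw [zero_add, Net.tail_one]; ring⟩
  · intro w hw1 hw2
    rw [zero_add, Net.tail_one] at hw2
    obtain ⟨h0, h1, h2⟩ := hw1
    have h3 : f.load w < G.k := by omega
    have h4 : w = s.reg 9 - 1 := by omega
    subst h4
    simp only [Test.Holds, Test.holds_lt, Expr.eval, hl, hk]
    exact ⟨trivial, by omega, h3⟩

theorem scanRight_wp (hG : G.Valid) (hs : s.Searching G f r 1) :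
    scanRight.wp T (State.Searching G f r 2) s := by
  have hm := hs.mem
  have hl : s.arr 6 = f.price := by rw [← hs.flow]; rfl
  have hn := hs.net.nodes
  refine tryVisit_wp hG hs (y := 1) (v := s.reg 9 + 1) ?_ ?_ ?_
  · intro s' h1 h2
    simp [Expr.eval, h1]
  · simp only [Test.Holds, Test.holds_lt, Test.holds_eq, Expr.eval, hl, hn]
    rintro ⟨h1, h2⟩
    exact ⟨Net.arc_two (by omega) (by omega) (by simpa using h2),
      by rw [one_add_one_eq_two, Net.tail_two]; ring⟩
  · intro w hw1 hw2
    rw [one_add_one_eq_two, Net.tail_two] at hw2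
    obtain ⟨h0, h1, h2⟩ := hw1
    have h3 : f.price (w - 1) = f.price w := by omega
    have h4 : w = s.reg 9 + 1 := by omega
    subst h4
    simp only [Test.Holds, Test.holds_lt, Test.holds_eq, Expr.eval, hl, hn]
    exact ⟨trivial, by omega, by simpa using h3⟩

theorem scanPartner_wp (hG : G.Valid) (hs : s.Searching G f r 2) :
    scanPartner.wp T (State.Searching G f r 3) s := by
  have hm := hs.mem
  have hw : s.arr 7 = f.weight := by rw [← hs.flow]; rfl
  have hp : s.arr 6 = f.price := by rw [← hs.flow]; rfl
  have hx : s.arr 8 = f.sel := by rw [← hs.flow]; rfl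
  obtain ⟨hi0, hi1, hi2⟩ := hG.owner_spec _ hm.1 hm.2
  have hs0 := hG.start_nonneg _ hi0 hi1
  have hsf := hG.start_lt_finish _ hi0 hi1
  have hf := hG.finish_lt _ hi0 hi1
  have hs' : (s.setReg 10 (G.owner (s.reg 9))).Searching G f r 2 := by
    obtain ⟨hn, hf, hS, hc, hl⟩ := hs
    exact ⟨⟨hn.n, hn.k, hn.nodes, hn.start, hn.finish, hn.owner⟩, hf, hS, hc, hl⟩
  -- Since `partner` is an involution, a type `3` arc out of a node leads to its partner, and the
  -- conditions at the head can be read at the tail with start and end exchanged.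
  have hkey : ∀ w, G.Arc f 3 w → G.tail 3 w = s.reg 9 → w = G.partner (s.reg 9) ∧
      f.weight (G.owner (s.reg 9)) = G.cost f (G.owner (s.reg 9)) ∧
      (G.start (G.owner (s.reg 9)) = s.reg 9 → f.sel (G.owner (s.reg 9)) = 0) ∧
      (G.start (G.owner (s.reg 9)) ≠ s.reg 9 → f.sel (G.owner (s.reg 9)) = 1) := by
    rintro w ⟨h0, h1, h2⟩ hw2
    rw [Net.tail_three] at hw2
    have h3 := hG.partner_partner h0 h1
    have h4 := hG.owner_partner h0 h1
    rw [hw2] at h3 h4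
    rw [← h4] at h2
    refine ⟨h3.symm, by omega, fun h => ?_, fun h => ?_⟩
    · rw [Net.partner, if_pos h] at h3
      omega
    · rw [Net.partner, if_neg h] at h3
      omega
  simp only [scanPartner, Prog.wp, Expr.eval, hs.net.owner]
  refine ⟨fun hb => ?_, fun hb => ?_⟩ <;>
    simp only [Test.holds_eq, Expr.eval, hs'.net.start] at hb <;>
    simp at hb <;>
    refine tryVisit_wp hG hs' (y := 2) (v := G.partner (s.reg 9)) ?_ ?_ ?_
  · intro s' h1 h2
    simp [Expr.eval, h1, h2, hs'.net.finish, Net.partner, hb]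
  · simp only [tight, Test.Holds, Test.holds_eq, Expr.eval, hs'.net.finish, hs'.net.start]
    simp only [State.reg_setReg, State.arr_setReg, Function.update_self, hw, hp, hx]
    rintro ⟨h1, h2⟩
    rw [Net.partner, if_pos hb]
    refine ⟨hG.arc_finish hi0 hi1 h1 h2, ?_⟩
    rw [show (2 : ℤ) + 1 = 3 by norm_num, Net.tail_three, hG.partner_finish hi0 hi1, hb]
    simp
  · intro w hw1 hw2
    obtain ⟨h1, h2, h3, -⟩ := hkey w hw1 (by simpa using hw2)
    simp only [tight, Test.Holds, Test.holds_eq, Expr.eval, hs'.net.finish, hs'.net.start]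
    simp only [State.reg_setReg, State.arr_setReg, Function.update_self, hw, hp, hx]
    exact ⟨h1, h2, h3 hb⟩
  · intro s' h1 h2
    simp [Expr.eval, h1, h2, hs'.net.start, Net.partner, hb]
  · simp only [tight, Test.Holds, Test.holds_eq, Expr.eval, hs'.net.finish, hs'.net.start]
    simp only [State.reg_setReg, State.arr_setReg, Function.update_self, hw, hp, hx]
    rintro ⟨h1, h2⟩
    rw [Net.partner, if_neg hb]
    refine ⟨hG.arc_start hi0 hi1 h1 h2, ?_⟩
    rw [show (2 : ℤ) + 1 = 3 by norm_num, Net.tail_three, hG.partner_start hi0 hi1]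
    simp
    omega
  · intro w hw1 hw2
    obtain ⟨h1, h2, -, h3⟩ := hkey w hw1 (by simpa using hw2)
    simp only [tight, Test.Holds, Test.holds_eq, Expr.eval, hs'.net.finish, hs'.net.start]
    simp only [State.reg_setReg, State.arr_setReg, Function.update_self, hw, hp, hx]
    exact ⟨h1, h2, h3 hb⟩

/-- Process the next node of the queue. -/
def searchStep : Prog :=
  .set 9 (.get 11 (.reg 7)) ;; scanLeft ;; scanRight ;; scanPartner ;;
    .set 7 (.add (.reg 7) (.const 1))

/-- Breadth-first search. -/
def search : Prog := .while (.lt (.reg 7) (.reg 8)) searchStep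

/-- The memory holds a search that is about to process the next node. -/
structure State.Pausing (G : Net) (f : Flow) (r : ℤ) (s : State) : Prop where
  net : s.HasNet G
  flow : s.flow = f
  search : Net.Search G f r (s.arr 9) (s.arr 10) (s.arr 11) (s.reg 8) (s.reg 7) (s.reg 9) 0

theorem searchStep_wp (hG : G.Valid) (hs : s.Pausing G f r) (hlt : s.reg 7 < s.reg 8) :
    searchStep.wp T (fun s' => s'.Pausing G f r ∧ s'.reg 7 = s.reg 7 + 1) s := by
  obtain ⟨hn, hf, hS⟩ := hs
  have h0 : (s.setReg 9 (s.arr 11 (s.reg 7))).Searching G f r 0 :=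
    ⟨⟨hn.n, hn.k, hn.nodes, hn.start, hn.finish, hn.owner⟩, hf, hS.take _, rfl, hlt⟩
  refine (scanLeft_wp hG h0).agree.mono fun s₁ h₁ => (scanRight_wp hG h₁.1).agree.mono fun s₂ h₂ =>
    (scanPartner_wp hG h₂.1).agree.mono fun s₃ h₃ => ?_
  obtain ⟨⟨hn, hf, hS, hc, hl⟩, h3⟩ := h₃
  have e3 := h3.1 7 (by decide)
  have e2 := h₂.2.1 7 (by decide)
  have e1 := h₁.2.1 7 (by decide)
  simp at e1
  refine ⟨⟨⟨hn.n, hn.k, hn.nodes, hn.start, hn.finish, hn.owner⟩, hf, ?_⟩, ?_⟩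
  · simpa [Expr.eval] using hS.next hG hc hl
  · simp [Expr.eval]
    omega

/-- Each round processes one entry of a queue of at most `2 n` nodes, so `2 n - s.reg 7` bounds the
remaining rounds. -/
theorem search_halts (hG : G.Valid) {n : ℕ} (hn : G.n = n) (hs : s.Pausing G f r)
    (h7 : s.reg 7 = 0) :
    Halts T search s (n * 400 + 5) fun s' => s'.Pausing G f r ∧ s'.reg 7 = s'.reg 8 := by
  refine Halts.mono (Halts.while (B := searchStep.bound)
    (fun m s' => s'.Pausing G f r ∧ s'.reg 7 + m = 2 * G.n) ?_ (2 * n) ⟨hs, by omega⟩) ?_ ?_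
  · rintro m s' - ⟨h1, h2⟩ hb
    simp only [Test.holds_lt, Expr.eval] at hb
    have := h1.search.length_le (by omega)
    refine ⟨m - 1, by omega, (searchStep_wp hG h1 hb).halts.mono le_rfl ?_⟩
    rintro s'' ⟨h3, h4⟩
    exact ⟨h3, by omega⟩
  · have h1 : searchStep.bound = 181 := by decide
    have h2 : (Test.lt (.reg 7) (.reg 8)).cost = 4 := by decide
    rw [h1, h2]
    omega
  · rintro s' ⟨⟨m, h1, -⟩, h2⟩
    simp only [Test.holds_lt, Expr.eval] at h2
    have := h1.search.le
    exact ⟨h1, by omega⟩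

end TVSlots

namespace TVSlots

variable {T : TimeTable → ℤ → ℝ} {G : Net} {s : State}

/-! ### Changing the flow by a program -/

/-- One step back on the path that a search has found. -/
def walkStep : Prog :=
  .ite (.eq (.get 10 (.reg 9)) (.const 1))
    (.put 5 (.reg 9) (.add (.get 5 (.reg 9)) (.const 1)) ;; .set 9 (.add (.reg 9) (.const 1)))
    (.ite (.eq (.get 10 (.reg 9)) (.const 2))
      (.set 9 (.sub (.reg 9) (.const 1)) ;;
        .put 5 (.reg 9) (.sub (.get 5 (.reg 9)) (.const 1)))
      (.set 10 (.get 4 (.reg 9)) ;;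
        .ite (.eq (.get 2 (.reg 10)) (.reg 9))
          (.put 8 (.reg 10) (.const 0) ;; .set 9 (.get 3 (.reg 10)))
          (.put 8 (.reg 10) (.const 1) ;; .set 9 (.get 2 (.reg 10)))))

/-- Change the flow along the path that a search has found. -/
def walk : Prog := .while (.not (.eq (.reg 9) (.get 3 (.reg 3)))) walkStep

/-- The memory holds a walk that has arrived at node `s.reg 9`. -/
structure State.Walking (G : Net) (r : ℤ) (s : State) : Prop where
  net : s.HasNet G
  walk : Net.Walk G s.flow r (s.arr 9) (s.arr 10) (s.reg 9)

theorem walkStep_wp (hG : G.Valid) {r : ℤ} (hs : s.Walking G r) (hc : s.reg 9 ≠ r) :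
    walkStep.wp T
      (fun s' => s'.Walking G r ∧ s'.arr 9 (s'.reg 9) < s.arr 9 (s.reg 9)) s := by
  obtain ⟨hn, hw⟩ := hs
  obtain ⟨-, -, hlt⟩ := hw.arc hc
  refine ⟨fun h1 => ?_, fun h1 => ⟨fun h2 => ?_, fun h2 => ?_⟩⟩
  · simp only [Test.holds_eq, Expr.eval] at h1
    rw [h1, Net.tail_one] at hlt
    refine ⟨⟨⟨hn.n, hn.k, hn.nodes, hn.start, hn.finish, hn.owner⟩, ?_⟩, by simpa [Expr.eval]⟩
    simpa [Expr.eval, State.flow] using hw.step_one hG hc h1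
  · simp only [Test.holds_eq, Expr.eval] at h1 h2
    rw [h2, Net.tail_two] at hlt
    refine ⟨⟨⟨hn.n, hn.k, hn.nodes, hn.start, hn.finish, hn.owner⟩, ?_⟩, by simpa [Expr.eval]⟩
    simpa [Expr.eval, State.flow] using hw.step_two hG hc h2
  · simp only [Test.holds_eq, Expr.eval] at h1 h2
    have h3 : s.arr 10 (s.reg 9) = 3 := by
      have := (hw.arc hc).1.2.2
      omega
    have := hw.step_three hG hc h1 h2
    rw [h3, Net.tail_three] at hlt
    refine ⟨fun h4 => ?_, fun h4 => ?_⟩ <;> simp [Expr.eval, hn.owner, hn.start] at h4 <;>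
      simp only [Net.partner, h4, if_true, if_false] at this hlt <;>
      refine ⟨⟨⟨hn.n, hn.k, hn.nodes, hn.start, hn.finish, hn.owner⟩, ?_⟩, ?_⟩ <;>
      simpa [Expr.eval, State.flow, hn.owner, hn.start, hn.finish]

/-- The queue position of the current node is positive and drops in every round, so it bounds the
remaining rounds. -/
theorem walk_halts (hG : G.Valid) {n : ℕ} {r : ℤ} (hr : r = G.finish (s.reg 3))
    (hs : s.Walking G r) (hord : s.arr 9 (s.reg 9) ≤ 2 * n) :
    Halts T walk s (n * 100 + 11) fun s' => s'.HasNet G ∧ G.Kilter s'.flow := by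
  have htest : ∀ s' : State, Agree walkStep s s' → s'.HasNet G →
      ((Test.not (.eq (.reg 9) (.get 3 (.reg 3)))).Holds T s' ↔ s'.reg 9 ≠ r) := by
    intro s' ha hn
    have := ha.1 3 (by decide)
    simp [Test.Holds, Expr.eval, hn.finish, this, hr]
  refine Halts.mono (Halts.agree (Halts.while (B := walkStep.bound)
    (fun m s' => s'.Walking G r ∧ s'.arr 9 (s'.reg 9) ≤ m) ?_ (2 * n)
    ⟨hs, by exact_mod_cast hord⟩)) ?_ ?_
  · rintro m s' ha ⟨h1, h2⟩ hb
    have hpos := h1.walk.pos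
    refine ⟨m - 1, by omega, (walkStep_wp hG h1 ((htest s' ha h1.net).1 hb)).halts.mono le_rfl ?_⟩
    rintro s'' ⟨h3, h4⟩
    exact ⟨h3, by omega⟩
  · have h1 : walkStep.bound = 39 := by decide
    have h2 : (Test.not (.eq (.reg 9) (.get 3 (.reg 3)))).cost = 10 := by decide
    rw [h1, h2]
    omega
  · rintro s' ⟨⟨⟨m, h1, -⟩, h2⟩, ha⟩
    have ha : Agree walkStep s s' := ha
    rw [htest s' ha h1.net, not_not] at h2
    have h3 := h1.walk
    rw [h2] at h3
    exact ⟨h1.net, h3.kilter⟩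

/-- Increase the prices of the nodes that a search has found. -/
def raise : Prog :=
  .for 6 2 (.ite (.eq (.get 9 (.reg 6)) (.const 0)) .skip
    (.put 6 (.reg 6) (.add (.get 6 (.reg 6)) (.const 1))))

theorem raise_halts {n : ℕ} (hn : s.reg 2 = 2 * n) :
    Halts T raise s (n * 60 + 10) fun s' => ∀ v : ℤ, 0 ≤ v → v < 2 * n →
      s'.arr 6 v = s.arr 6 v + if s.arr 9 v = 0 then 0 else 1 := by
  refine (Halts.for (B := 16) 6 2 (2 * n) (fun m s' => ∀ v : ℤ, s'.arr 6 v =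
    s.arr 6 v + if 0 ≤ v ∧ v < m ∧ s.arr 9 v ≠ 0 then 1 else 0) (by decide) (by decide)
    (by decide) (by simpa using hn) ?_ ?_).mono ?_ ?_
  · intro v
    simp
    omega
  · intro i s' hi ha h6 hI
    refine Halts.mono (Prog.wp.halts ?_) (by decide) fun s' h => h
    have h9 := ha.2 9 (by decide)
    refine ⟨fun h v => ?_, fun h v => ?_⟩ <;>
      simp [Expr.eval, h6, h9] at h <;>
      have := hI v
    · simp only [State.arr_setReg, this]
      split_ifs with h1 h2 h2
      · rfl
      · omega
      · have : v = i := by omega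
        subst this
        omega
      · rfl
    · simp only [State.arr_setReg, State.arr_setArr, Function.update_self, Expr.eval, h6]
      by_cases hv : v = i
      · subst hv
        simp [this, h]
      · simp only [Function.update_of_ne hv, this]
        split_ifs <;> omega
  · omega
  · rintro s' ⟨h, -⟩ v h0 h1
    rw [h v]
    split_ifs <;> simp at * <;> omega

/-- Forget the previous search. -/
def clear : Prog := .for 6 2 (.put 9 (.reg 6) (.const 0))

theorem clear_halts {n : ℕ} (hn : s.reg 2 = 2 * n) :
    Halts T clear s (n * 24 + 10) fun s' => ∀ v : ℤ, 0 ≤ v → v < 2 * n → s'.arr 9 v = 0 := by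
  refine (Halts.for (B := 3) 6 2 (2 * n) (fun m s' => ∀ v : ℤ, 0 ≤ v → v < m → s'.arr 9 v = 0)
    (by decide) (by decide) (by decide) (by simpa using hn) ?_ ?_).mono ?_ ?_
  · intro v
    omega
  · intro i s' hi ha h6 hI
    refine Halts.mono (Prog.wp.halts ?_) (by decide) fun s' h => h
    intro v h0 h1
    have := hI v h0
    simp [Function.update_apply, Expr.eval, h6]
    omega
  · omega
  · rintro s' ⟨h, -⟩ v h0 h1
    exact h v h0 (by simpa using h1)

/-- Prepare a search from the end of the programme `s.reg 3`. -/
def startSearch : Prog :=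
  .put 9 (.get 3 (.reg 3)) (.const 1) ;; .put 11 (.const 0) (.get 3 (.reg 3)) ;;
    .set 7 (.const 0) ;; .set 8 (.const 1)

/-- Select the programme `s.reg 3`. -/
def startWalk : Prog := .put 8 (.reg 3) (.const 1) ;; .set 9 (.get 2 (.reg 3))

/-- Restore optimality when the weight of the programme `s.reg 3` exceeds its price by one. -/
def repair : Prog :=
  clear ;; startSearch ;; search ;;
    .ite (.eq (.get 9 (.get 2 (.reg 3))) (.const 0)) raise (startWalk ;; walk)

/-- One search suffices because the excess is exactly one: the price change removes it, while a
selected programme may have a weight above its cost. -/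
theorem repair_halts (hG : G.Valid) {n : ℕ} (hn : G.n = n) {j : ℤ} (hj : s.reg 3 = j)
    (hs : s.HasNet G) (hj0 : 0 ≤ j) (hj1 : j < G.n)
    (hint : ∀ i, 0 ≤ i → i < G.n → i ≠ j → G.IntervalSlack s.flow i) (hgap : G.GapSlack s.flow)
    (hload : ∀ v, 0 ≤ v → v < 2 * G.n → s.flow.load v = G.depth s.flow.sel v)
    (hsel : s.flow.sel j = 0) (hw : s.flow.weight j = G.cost s.flow j + 1) :
    Halts T repair s (n * 600 + 100) fun s' => s'.HasNet G ∧ G.Kilter s'.flow := by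
  have hs0 := hG.start_nonneg j hj0 hj1
  have hsf := hG.start_lt_finish j hj0 hj1
  have hf := hG.finish_lt j hj0 hj1
  obtain ⟨f, hfl⟩ : ∃ f, s.flow = f := ⟨_, rfl⟩
  rw [hfl] at hint hgap hload hsel hw
  have hclear := (clear_halts (T := T) (n := n) (by rw [hs.nodes, hn])).agree
  have hstart : ∀ s₁ : State, (∀ v : ℤ, 0 ≤ v → v < 2 * n → s₁.arr 9 v = 0) ∧ Agree clear s s₁ →
      Halts T startSearch s₁ startSearch.bound fun s₂ =>
        s₂.Pausing G f (G.finish j) ∧ s₂.reg 7 = 0 ∧ s₂.reg 3 = j := by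
    rintro s₁ ⟨h9, ha⟩
    have hn₁ := ha.hasNet hs
    have hf₁ := ha.flow
    have h3 : s₁.reg 3 = j := by rw [ha.1 3 (by decide), hj]
    refine Prog.wp.halts ⟨⟨⟨hn₁.n, hn₁.k, hn₁.nodes, hn₁.start, hn₁.finish, hn₁.owner⟩, ?_, ?_⟩,
      ?_, ?_⟩
    · rw [← hfl, ← hf₁]
      rfl
    · have := Net.Search.init (f := f) (typ := s₁.arr 10) (u := 0) (que := s₁.arr 11)
        (hs0.trans hsf.le) hf (by rwa [hn]) hG
      simpa [Expr.eval, h3, hn₁.finish] using this.take _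
    · simp [Expr.eval]
    · simpa using h3
  have hsearch : ∀ s₂ : State,
      s₂.Pausing G f (G.finish j) ∧ s₂.reg 7 = 0 ∧ s₂.reg 3 = j →
      Halts T search s₂ (n * 400 + 5) fun s₃ =>
        (s₃.Pausing G f (G.finish j) ∧ s₃.reg 7 = s₃.reg 8) ∧ s₃.reg 3 = j := by
    rintro s₂ ⟨h1, h2, h3⟩
    refine (search_halts hG hn h1 h2).agree.mono le_rfl ?_
    rintro s₃ ⟨h4, h5⟩
    exact ⟨h4, by rw [h5.1 3 (by decide), h3]⟩
  have hend : ∀ s₃ : State,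
      (s₃.Pausing G f (G.finish j) ∧ s₃.reg 7 = s₃.reg 8) ∧ s₃.reg 3 = j →
      Halts T (.ite (.eq (.get 9 (.get 2 (.reg 3))) (.const 0)) raise (startWalk ;; walk)) s₃
        ((Test.eq (.get 9 (.get 2 (.reg 3))) (.const 0)).cost + (n * 100 + 30) + 1)
        fun s' => s'.HasNet G ∧ G.Kilter s'.flow := by
    rintro s₃ ⟨⟨⟨hn₃, hf₃, hS⟩, h78⟩, h3⟩
    rw [h78] at hS
    refine Halts.ite (fun h => ?_) fun h => ?_ <;>
      simp only [Test.holds_eq, Expr.eval, h3, hn₃.start] at h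
    · refine (raise_halts (n := n) (by rw [hn₃.nodes, hn])).agree.mono (by omega) ?_
      rintro s' ⟨hr, ha⟩
      refine ⟨ha.hasNet hn₃, ?_⟩
      have := Net.Kilter.raise hG (price := s'.arr 6) hj0 hj1 hint hgap hload hsel hw hS.root h
        (fun z v => hS.closed_of_eq hG) (by rw [← hf₃, hn]; exact hr)
      rw [← hf₃] at this
      simpa [State.flow, ha.2 5 (by decide), ha.2 7 (by decide), ha.2 8 (by decide)] using this
    · have hW := Net.Walk.init hG hj0 hj1 hint hgap hload hsel hw hS h
      have hle : s₃.arr 9 (G.start j) ≤ 2 * n := by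
        have h1 := (hS.found _ hs0 (by omega) h).2.1
        have h2 := hS.length_le (by omega)
        omega
      refine Halts.mono (Halts.seq (B := startWalk.bound) (Prog.wp.halts
        (Q := fun s' => s'.Walking G (G.finish j) ∧ s'.reg 3 = j ∧ s'.arr 9 (s'.reg 9) ≤ 2 * n) ?_)
        (fun s' h' => walk_halts hG (by rw [h'.2.1]) h'.1 h'.2.2)) ?_ fun _ h => h
      · refine ⟨⟨⟨hn₃.n, hn₃.k, hn₃.nodes, hn₃.start, hn₃.finish, hn₃.owner⟩, ?_⟩, ?_, ?_⟩
        · rw [← hf₃] at hW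
          simpa [Expr.eval, State.flow, h3, hn₃.start] using hW
        · simpa using h3
        · simpa [Expr.eval, h3, hn₃.start] using hle
      · have : startWalk.bound = 6 := by decide
        omega
  refine (hclear.seq fun s₁ h₁ => (hstart s₁ h₁).seq fun s₂ h₂ => (hsearch s₂ h₂).seq hend).mono
    ?_ fun _ h => h
  have h1 : startSearch.bound = 12 := by decide
  have h2 : (Test.eq (.get 9 (.get 2 (.reg 3))) (.const 0)).cost = 11 := by decide
  omega

/-- Increase the weight of the programme `s.reg 3` by one. -/
def increase : Prog :=
  .put 7 (.reg 3) (.add (.get 7 (.reg 3)) (.const 1)) ;;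
    .ite (.and (.eq (.get 8 (.reg 3)) (.const 0)) (.lt (.sub (.get 6 (.get 3 (.reg 3)))
      (.get 6 (.get 2 (.reg 3)))) (.get 7 (.reg 3)))) repair .skip

/-- A selected programme tolerates any increase of its weight. An unselected one had weight at most
its cost before, so any excess after the increase is exactly one, as `repair` requires. -/
theorem increase_halts (hG : G.Valid) {n : ℕ} (hn : G.n = n) (hs : s.HasNet G)
    (hj0 : 0 ≤ s.reg 3) (hj1 : s.reg 3 < G.n) (hk : G.Kilter s.flow) :
    Halts T increase s (n * 600 + 150) fun s' => (s'.HasNet G ∧ G.Kilter s'.flow) ∧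
      s'.arr 7 = Function.update (s.arr 7) (s.reg 3) (s.arr 7 (s.reg 3) + 1) := by
  set j := s.reg 3 with hj
  obtain ⟨h1, h2, h3⟩ := hk.interval j hj0 hj1
  obtain ⟨s₁, hs₁⟩ : ∃ s₁, s₁ = s.setArr 7 j (s.arr 7 j + 1) := ⟨_, rfl⟩
  have hn₁ : s₁.HasNet G := by
    subst hs₁
    exact ⟨hs.n, hs.k, hs.nodes, hs.start, hs.finish, hs.owner⟩
  have hj₁ : s₁.reg 3 = j := by simp [hs₁, hj]
  have hf₁ : s₁.flow = { s.flow with weight := Function.update (s.arr 7) j (s.arr 7 j + 1) } := by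
    subst hs₁
    rfl
  have hint : ∀ i, 0 ≤ i → i < G.n → i ≠ j → G.IntervalSlack s₁.flow i := by
    intro i h4 h5 hi
    obtain ⟨h6, h7, h8⟩ := hk.interval i h4 h5
    rw [hf₁]
    exact ⟨h6, by simpa [hi, Net.cost, State.flow] using h7, by simpa [hi, Net.cost, State.flow] using h8⟩
  have hgap : G.GapSlack s₁.flow := by
    rw [hf₁]
    exact ⟨hk.gap.mono, hk.gap.load_le, hk.gap.tight⟩
  have hload : ∀ v, 0 ≤ v → v < 2 * G.n → s₁.flow.load v = G.depth s₁.flow.sel v := by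
    rw [hf₁]
    exact hk.load
  have h7 : s₁.arr 7 = Function.update (s.arr 7) j (s.arr 7 j + 1) := by simp [hs₁]
  have hc : s₁.arr 6 (G.finish j) - s₁.arr 6 (G.start j) = G.cost s.flow j := by
    simp [hs₁, Net.cost, State.flow]
  have hc' : G.cost s₁.flow j = G.cost s.flow j := by
    simp [hf₁, Net.cost]
  have h8 : s₁.arr 8 = s.flow.sel := by simp [hs₁, State.flow]
  have hwj : s.flow.weight j = s.arr 7 j := rfl
  have hwj' : s₁.flow.weight j = s.arr 7 j + 1 := by simp [hf₁]
  have hx : s₁.flow.sel = s.flow.sel := by rw [hf₁]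
  refine Halts.mono (Halts.seq (B := 7) (R := fun s' => s' = s₁)
    ⟨_, _, .put _ _ _ _, by decide, by simp [Expr.eval, hs₁, hj]⟩ (B' := 21 + (n * 600 + 100) + 1)
    ?_) (by omega) fun _ h => h
  rintro _ rfl
  refine Halts.ite (b := .and _ _) (fun hb => ?_) fun hb => ?_ <;>
    simp only [Test.Holds, Test.holds_eq, Test.holds_lt, Expr.eval, hj₁, hn₁.start, hn₁.finish,
      hc, h7, h8, Function.update_self] at hb
  · refine (repair_halts hG hn hj₁ hn₁ hj0 hj1 hint hgap hload (by rw [hx]; exact hb.1) ?_).agree.mono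
      le_rfl ?_
    · have := h3 hb.1
      omega
    · rintro s' ⟨h4, h5⟩
      exact ⟨h4, by rw [h5.2 7 (by decide), h7]⟩
  · refine ⟨_, _, .skip _, by omega, ⟨hn₁, fun i hi0 hi1 => ?_, hgap, hload⟩, h7⟩
    by_cases hi : i = j
    · subst hi
      refine ⟨by rwa [hx], fun h => ?_, fun h => ?_⟩
      · rw [hx] at h
        have := h2 h
        omega
      · rw [hx] at h
        have : ¬ _ := fun h' => hb ⟨h, h'⟩
        omega
    · exact hint i hi0 hi1 hi

/-- Compute an optimal flow for the weights given by array `0`. -/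
def optimize : Prog := .for 3 0 (.set 5 (.get 0 (.reg 3)) ;; .for 4 5 increase)

/-- The flow stays in kilter for weights that are final on the programmes already treated and zero
on later ones. The factor `M` enters as the bound on the rounds of the inner loop. -/
theorem optimize_halts (hG : G.Valid) {n M : ℕ} (hn : G.n = n) (hs : s.HasNet G)
    (hk : G.Kilter s.flow) (h7 : ∀ i, s.arr 7 i = 0) (h0 : ∀ i, 0 ≤ s.arr 0 i)
    (hM : ∀ i, s.arr 0 i ≤ M) :
    Halts T optimize s (n * (M * (n * 600 + 159) + 20) + 7) fun s' => s'.HasNet G ∧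
      G.Kilter s'.flow ∧ ∀ i, 0 ≤ i → i < G.n → s'.arr 7 i = s.arr 0 i := by
  refine (Halts.for (B := M * (n * 600 + 159) + 11) 3 0 n (fun m s' => s'.HasNet G ∧
    G.Kilter s'.flow ∧ ∀ i : ℤ, s'.arr 7 i = if 0 ≤ i ∧ i < m then s.arr 0 i else 0) (by decide)
    (by decide) (by decide) (by rw [hs.n, hn]) ?_ ?_).mono (by ring_nf; omega) ?_
  · refine ⟨⟨hs.n, hs.k, hs.nodes, hs.start, hs.finish, hs.owner⟩, hk, fun i => ?_⟩
    rw [if_neg (by omega)]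
    exact h7 i
  · rintro i s' hi ha h3 ⟨hn', hk', h7'⟩
    have h0' : s'.arr 0 = s.arr 0 := ha.2 0 (by decide)
    obtain ⟨w, hw⟩ := Int.eq_ofNat_of_zero_le (h0 i)
    have hwM : w ≤ M := by
      have := hM i
      omega
    refine Halts.mono (Halts.seq (B := 4) (R := fun s₁ => s₁ = s'.setReg 5 w)
      ⟨_, _, .set _ _ _, by decide, by simp [Expr.eval, h3, h0', hw]⟩
      (B' := w * (n * 600 + 159) + 7) ?_)
      (by have := Nat.mul_le_mul_right (n * 600 + 159) hwM; omega) fun _ h => h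
    rintro _ rfl
    refine (Halts.for 4 5 w (fun m s₁ => s₁.HasNet G ∧ G.Kilter s₁.flow ∧
      s₁.arr 7 = Function.update (s'.arr 7) i m) (by decide) (by decide) (by decide)
      (by simp) ?_ ?_).mono le_rfl ?_
    · refine ⟨⟨hn'.n, hn'.k, hn'.nodes, hn'.start, hn'.finish, hn'.owner⟩, hk', ?_⟩
      have := h7' i
      rw [if_neg (by omega)] at this
      simp [← this]
    · rintro m s₁ hm ha₁ - ⟨hn₁, hk₁, h7₁⟩
      have h3₁ : s₁.reg 3 = i := by
        rw [ha₁.1 3 (by decide)]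
        simpa using h3
      refine (increase_halts hG hn hn₁ (by omega) (by omega) hk₁).mono le_rfl ?_
      rintro s₂ ⟨⟨hn₂, hk₂⟩, h7₂⟩
      refine ⟨⟨hn₂.n, hn₂.k, hn₂.nodes, hn₂.start, hn₂.finish, hn₂.owner⟩, hk₂, ?_⟩
      simp [h7₂, h7₁, h3₁]
    · rintro s₂ ⟨⟨hn₂, hk₂, h7₂⟩, -⟩
      refine ⟨⟨hn₂.n, hn₂.k, hn₂.nodes, hn₂.start, hn₂.finish, hn₂.owner⟩, hk₂, fun v => ?_⟩
      simp only [State.arr_setReg, h7₂, Function.update_apply, h7']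
      by_cases hv : v = i
      · subst hv
        simp [hw]
      · simp only [hv, if_false]
        congr 1
        apply propext
        push_cast
        omega
  · rintro s' ⟨⟨h1, h2, h3⟩, -⟩
    refine ⟨h1, h2, fun i hi0 hi1 => ?_⟩
    rw [h3, if_pos (by omega)]

end TVSlots

namespace TVSlots

/-! ### Sorting the endpoints -/

section Rank

variable (T : TimeTable → ℤ → ℝ) (n : ℕ)

/-- The sorting key of the start of programme `i`. -/
def startKey (i : ℕ) : ℝ ×ₗ ℕ := toLex (T .start i, n + i)

/-- The sorting key of the end of programme `i`; ends come before starts at the same time. -/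
def finishKey (i : ℕ) : ℝ ×ₗ ℕ := toLex (T .finish i, i)

open Classical in
/-- The number of endpoints of the first `m` programmes with a key below `e`. -/
noncomputable def rank (m : ℕ) (e : ℝ ×ₗ ℕ) : ℕ :=
  ∑ j ∈ Finset.range m,
    ((if startKey T n j < e then 1 else 0) + if finishKey T j < e then 1 else 0)

variable {T n}

theorem rank_succ (m : ℕ) (e : ℝ ×ₗ ℕ) : rank T n (m + 1) e = rank T n m e +
    ((if startKey T n m < e then 1 else 0) + if finishKey T m < e then 1 else 0) :=
  Finset.sum_range_succ _ _

/-- This and the next three equivalences express the order of keys by `≤` between times and indices,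
which are the tests available to a program. Adding `n` to the tie-breaker of starts puts ends first.
-/
theorem startKey_lt_startKey {i j : ℕ} : startKey T n j < startKey T n i ↔
    T .start j ≤ T .start i ∧ ¬ (T .start i ≤ T .start j ∧ i ≤ j) := by
  simp only [startKey, Prod.Lex.toLex_lt_toLex]
  constructor
  · rintro (h | ⟨h, h'⟩)
    · exact ⟨h.le, fun h'' => by linarith [h''.1]⟩
    · exact ⟨h.le, fun h'' => by omega⟩
  · rintro ⟨h, h'⟩
    rcases h.lt_or_eq with h1 | h1
    · exact Or.inl h1
    · refine Or.inr ⟨h1, ?_⟩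
      by_contra hc
      exact h' ⟨h1.ge, by omega⟩

theorem finishKey_lt_startKey {i j : ℕ} (hj : j < n) : finishKey T j < startKey T n i ↔
    T .finish j ≤ T .start i := by
  simp only [startKey, finishKey, Prod.Lex.toLex_lt_toLex, le_iff_lt_or_eq]
  refine or_congr_right (and_iff_left_of_imp fun _ => by omega)

theorem startKey_lt_finishKey {i j : ℕ} (hi : i < n) : startKey T n j < finishKey T i ↔
    ¬ T .finish i ≤ T .start j := by
  simp only [startKey, finishKey, Prod.Lex.toLex_lt_toLex, not_le]
  exact or_iff_left fun h => by omega

theorem finishKey_lt_finishKey {i j : ℕ} : finishKey T j < finishKey T i ↔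
    T .finish j ≤ T .finish i ∧ ¬ (T .finish i ≤ T .finish j ∧ i ≤ j) := by
  simp only [finishKey, Prod.Lex.toLex_lt_toLex]
  constructor
  · rintro (h | ⟨h, h'⟩)
    · exact ⟨h.le, fun h'' => by linarith [h''.1]⟩
    · exact ⟨h.le, fun h'' => by omega⟩
  · rintro ⟨h, h'⟩
    rcases h.lt_or_eq with h1 | h1
    · exact Or.inl h1
    · refine Or.inr ⟨h1, ?_⟩
      by_contra hc
      exact h' ⟨h1.ge, by omega⟩

/-- Every endpoint below `e` is below `e'`, and `e` itself is counted only for `e'`. -/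
theorem rank_lt_rank {i : ℕ} (hi : i < n) {e e' : ℝ ×ₗ ℕ}
    (he : e = startKey T n i ∨ e = finishKey T i) (h : e < e') : rank T n n e < rank T n n e' := by
  refine Finset.sum_lt_sum (fun j _ => ?_) ⟨i, Finset.mem_range.2 hi, ?_⟩
  · have h1 : startKey T n j < e → startKey T n j < e' := fun h' => h'.trans h
    have h2 : finishKey T j < e → finishKey T j < e' := fun h' => h'.trans h
    split_ifs <;> simp_all
  · have h1 : startKey T n i < e → startKey T n i < e' := fun h' => h'.trans h
    have h2 : finishKey T i < e → finishKey T i < e' := fun h' => h'.trans h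
    rcases he with rfl | rfl
    · rw [if_neg (lt_irrefl _), if_pos h]
      split_ifs <;> simp_all
    · rw [if_neg (lt_irrefl (finishKey T i)), if_pos h]
      split_ifs <;> simp_all

/-- The endpoint `e` is one of the `2 n` and is not below itself. -/
theorem rank_lt {i : ℕ} (hi : i < n) {e : ℝ ×ₗ ℕ}
    (he : e = startKey T n i ∨ e = finishKey T i) : rank T n n e < 2 * n := by
  have : 2 * n = ∑ j ∈ Finset.range n, 2 := by simp [mul_comm]
  rw [this]
  refine Finset.sum_lt_sum (fun j _ => ?_) ⟨i, Finset.mem_range.2 hi, ?_⟩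
  · split_ifs <;> norm_num
  · rcases he with rfl | rfl
    · rw [if_neg (lt_irrefl _)]
      split_ifs <;> norm_num
    · rw [if_neg (lt_irrefl (finishKey T i))]
      split_ifs <;> norm_num

theorem rank_lt_rank_iff {i j : ℕ} (hi : i < n) (hj : j < n) {e e' : ℝ ×ₗ ℕ}
    (he : e = startKey T n i ∨ e = finishKey T i) (he' : e' = startKey T n j ∨ e' = finishKey T j) :
    rank T n n e < rank T n n e' ↔ e < e' := by
  refine ⟨fun h => ?_, rank_lt_rank hi he⟩
  by_contra hc
  rcases (not_lt.1 hc).lt_or_eq with h1 | h1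
  · exact h.not_gt (rank_lt_rank hj he' h1)
  · rw [h1] at h
    exact h.false

theorem rank_inj {i j : ℕ} (hi : i < n) (hj : j < n) {e e' : ℝ ×ₗ ℕ}
    (he : e = startKey T n i ∨ e = finishKey T i) (he' : e' = startKey T n j ∨ e' = finishKey T j)
    (h : rank T n n e = rank T n n e') : e = e' := by
  rcases lt_trichotomy e e' with h1 | h1 | h1
  · exact absurd h (rank_lt_rank hi he h1).ne
  · exact h1
  · exact absurd h (rank_lt_rank hj he' h1).ne'

/-- The second components are at least `n` for starts and below `n` for ends, so a key determines
its programme. -/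
theorem index_eq {i j : ℕ} (hi : i < n) (hj : j < n) {e : ℝ ×ₗ ℕ}
    (he : e = startKey T n i ∨ e = finishKey T i) (he' : e = startKey T n j ∨ e = finishKey T j) :
    i = j := by
  rcases he with rfl | rfl <;> rcases he' with h | h <;>
  · simp only [startKey, finishKey, toLex_inj, Prod.mk.injEq] at h
    omega

/-- Ranking is injective from the `2 n` endpoints to the `2 n` nodes, hence onto; this makes `owner`
meaningful at every node. -/
theorem exists_rank_eq {v : ℕ} (hv : v < 2 * n) :
    ∃ i < n, rank T n n (startKey T n i) = v ∨ rank T n n (finishKey T i) = v := by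
  let g : Fin n ⊕ Fin n → Fin (2 * n) := Sum.elim
    (fun i => ⟨rank T n n (startKey T n i), rank_lt i.2 (Or.inl rfl)⟩)
    fun i => ⟨rank T n n (finishKey T i), rank_lt i.2 (Or.inr rfl)⟩
  have hg : Function.Injective g := by
    rintro (i | i) (j | j) h <;> simp only [g, Sum.elim_inl, Sum.elim_inr, Fin.mk.injEq] at h
    · have h1 := rank_inj i.2 j.2 (Or.inl rfl) (Or.inl rfl) h
      rw [Fin.ext (index_eq i.2 j.2 (Or.inl rfl) (Or.inl h1))]
    · have h1 := rank_inj i.2 j.2 (Or.inl rfl) (Or.inr rfl) h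
      simp only [startKey, finishKey, toLex_inj, Prod.mk.injEq] at h1
      omega
    · have h1 := rank_inj i.2 j.2 (Or.inr rfl) (Or.inl rfl) h
      simp only [startKey, finishKey, toLex_inj, Prod.mk.injEq] at h1
      omega
    · have h1 := rank_inj i.2 j.2 (Or.inr rfl) (Or.inr rfl) h
      rw [Fin.ext (index_eq i.2 j.2 (Or.inr rfl) (Or.inr h1))]
  have hs := ((Fintype.bijective_iff_injective_and_card g).2 ⟨hg, by simp [two_mul]⟩).2
  obtain ⟨e | e, he⟩ := hs ⟨v, hv⟩
  · exact ⟨e, e.2, Or.inl (congrArg Fin.val he)⟩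
  · exact ⟨e, e.2, Or.inr (congrArg Fin.val he)⟩

end Rank

/-! ### The ranking program -/

/-- Increase register `x` by one if `b` holds. -/
def countIf (b : Test) (x : ℕ) : Prog := .ite b (.set x (.add (.reg x) (.const 1))) .skip

/-- Count the endpoints of programme `s.reg 6` that precede those of programme `s.reg 3`. -/
def rankStep : Prog :=
  countIf (.and (.timeLe .start (.reg 6) .start (.reg 3))
      (.not (.and (.timeLe .start (.reg 3) .start (.reg 6)) (.le (.reg 3) (.reg 6))))) 7 ;;
    countIf (.timeLe .finish (.reg 6) .start (.reg 3)) 7 ;;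
    countIf (.not (.timeLe .finish (.reg 3) .start (.reg 6))) 8 ;;
    countIf (.and (.timeLe .finish (.reg 6) .finish (.reg 3))
      (.not (.and (.timeLe .finish (.reg 3) .finish (.reg 6)) (.le (.reg 3) (.reg 6))))) 8

/-- Compute the net of a schedule. -/
def sortEndpoints : Prog :=
  .set 2 (.add (.reg 0) (.reg 0)) ;;
    .for 3 0 ((.set 7 (.const 0) ;; .set 8 (.const 0)) ;; .for 6 0 rankStep ;;
      .put 2 (.reg 3) (.reg 7) ;; .put 3 (.reg 3) (.reg 8) ;; .put 4 (.reg 7) (.reg 3) ;;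
      .put 4 (.reg 8) (.reg 3))

variable {T : TimeTable → ℤ → ℝ} {s : State}

open Classical in
theorem countIf_wp {b : Test} {x : ℕ} {Q : State → Prop}
    (h : Q (s.setReg x (s.reg x + if b.Holds T s then 1 else 0))) : (countIf b x).wp T Q s := by
  refine ⟨fun hb => ?_, fun hb => ?_⟩
  · rwa [if_pos hb] at h
  · have : s.setReg x (s.reg x) = s := by simp [State.setReg]
    simp only [Prog.wp]
    rwa [if_neg hb, add_zero, this] at h

theorem rankStep_wp {n i j : ℕ} (hi : i < n) (hj : j < n) (h3 : s.reg 3 = i) (h6 : s.reg 6 = j)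
    (h7 : s.reg 7 = rank T n j (startKey T n i)) (h8 : s.reg 8 = rank T n j (finishKey T i)) :
    rankStep.wp T (fun s' => s'.reg 7 = rank T n (j + 1) (startKey T n i) ∧
      s'.reg 8 = rank T n (j + 1) (finishKey T i)) s := by
  refine countIf_wp (countIf_wp (countIf_wp (countIf_wp ?_)))
  simp only [rank_succ, startKey_lt_startKey, finishKey_lt_startKey hj,
    startKey_lt_finishKey hi, finishKey_lt_finishKey]
  simp [Test.Holds, Expr.eval, h3, h6, h7, h8, add_assoc]

/-- The memory after the endpoints of the first `m` programmes have been ranked. -/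
structure State.Ranked (T : TimeTable → ℤ → ℝ) (n m : ℕ) (s : State) : Prop where
  start : ∀ i < m, s.arr 2 i = rank T n n (startKey T n i)
  finish : ∀ i < m, s.arr 3 i = rank T n n (finishKey T i)
  owner_start : ∀ i < m, s.arr 4 (rank T n n (startKey T n i)) = i
  owner_finish : ∀ i < m, s.arr 4 (rank T n n (finishKey T i)) = i

theorem State.Ranked.valid {n : ℕ} (hs : s.Ranked T n n) (k : ℤ)
    (hT : ∀ i < n, T .start i < T .finish i) :
    Net.Valid ⟨n, k, s.arr 2, s.arr 3, s.arr 4⟩ := by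
  have hnat : ∀ i : ℤ, 0 ≤ i → i < n → ∃ m : ℕ, i = m ∧ m < n := fun i h0 h1 =>
    ⟨i.toNat, by omega, by omega⟩
  constructor <;> dsimp only
  · intro i h0 h1
    obtain ⟨i, rfl, hi⟩ := hnat i h0 h1
    rw [hs.start i hi]
    omega
  · intro i h0 h1
    obtain ⟨i, rfl, hi⟩ := hnat i h0 h1
    rw [hs.start i hi, hs.finish i hi, Nat.cast_lt]
    refine rank_lt_rank hi (Or.inl rfl) ?_
    rw [startKey_lt_finishKey hi, not_le]
    exact hT i hi
  · intro i h0 h1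
    obtain ⟨i, rfl, hi⟩ := hnat i h0 h1
    rw [hs.finish i hi]
    have := rank_lt (T := T) hi (Or.inr rfl)
    omega
  · intro i h0 h1
    obtain ⟨i, rfl, hi⟩ := hnat i h0 h1
    rw [hs.start i hi, hs.owner_start i hi]
  · intro i h0 h1
    obtain ⟨i, rfl, hi⟩ := hnat i h0 h1
    rw [hs.finish i hi, hs.owner_finish i hi]
  · intro v h0 h1
    obtain ⟨v, rfl⟩ := Int.eq_ofNat_of_zero_le h0
    obtain ⟨i, hi, rfl | rfl⟩ := exists_rank_eq (T := T) (n := n) (v := v) (by omega)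
    · rw [hs.owner_start i hi, hs.start i hi]
      exact ⟨by omega, by omega, Or.inl rfl⟩
    · rw [hs.owner_finish i hi, hs.finish i hi]
      exact ⟨by omega, by omega, Or.inr rfl⟩

theorem sortEndpoints_halts {n k : ℕ} (h0 : s.reg 0 = n) (h1 : s.reg 1 = k)
    (hT : ∀ i < n, T .start i < T .finish i) :
    Halts T sortEndpoints s (n * (n * 60 + 32) + 11) fun s' => ∃ G : Net, G.Valid ∧ G.n = n ∧
      G.k = k ∧ s'.HasNet G ∧ ∀ i < n, ∀ j < n,
        (G.start i < G.finish j ↔ T .start i < T .finish j) := by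
  refine Halts.mono (Halts.seq (B := 4) (R := fun s' => s' = s.setReg 2 (2 * n))
    ⟨_, _, .set _ _ _, by decide, by simp [Expr.eval, h0, two_mul]⟩
    (B' := n * (n * 60 + 32) + 7) ?_) (by omega) fun _ h => h
  rintro _ rfl
  refine (Halts.for 3 0 n (fun m s' => s'.Ranked T n m) (by decide) (by decide) (by decide)
    (by simpa using h0) ?_ ?_).mono le_rfl ?_
  · constructor <;> simp
  · intro i s₁ hi ha h3 hR
    refine Halts.mono (Halts.seq (B := 4) (R := fun s₂ => s₂ = (s₁.setReg 7 0).setReg 8 0)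
      (Prog.wp.halts (p := .set 7 (.const 0) ;; .set 8 (.const 0)) rfl)
      (B' := (n * (51 + 9) + 7) + 12) ?_) (by omega) fun _ h => h
    rintro _ rfl
    have h0₁ : s₁.reg 0 = n := by
      rw [ha.1 0 (by decide)]
      simpa using h0
    refine Halts.seq (Halts.for 6 0 n (fun m s₂ => s₂.reg 7 = rank T n m (startKey T n i) ∧
      s₂.reg 8 = rank T n m (finishKey T i)) (by decide) (by decide) (by decide)
      (by simpa using h0₁) ?_ ?_) ?_
    · simp [rank]
    · rintro j s₂ hj ha₂ h6 ⟨h7, h8⟩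
      have h3₂ : s₂.reg 3 = i := by
        rw [ha₂.1 3 (by decide)]
        simpa using h3
      refine (rankStep_wp hi hj h3₂ h6 h7 h8).halts.mono (by decide) ?_
      rintro s₃ ⟨h7₃, h8₃⟩
      exact ⟨by simpa using h7₃, by simpa using h8₃⟩
    · rintro s₂ ⟨⟨h7, h8⟩, ha₂⟩
      have h3₂ : s₂.reg 3 = i := by
        rw [ha₂.1 3 (by decide)]
        simpa using h3
      have hR₂ : s₂.Ranked T n i := by
        obtain ⟨ha, hb, hc, hd⟩ := hR
        have h2 := ha₂.2 2 (by decide)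
        have h3 := ha₂.2 3 (by decide)
        have h4 := ha₂.2 4 (by decide)
        simp only [State.arr_setReg] at h2 h3 h4
        constructor <;> simpa only [h2, h3, h4]
      refine Halts.mono (Prog.wp.halts ?_) (by decide) fun _ h => h
      -- Endpoints of different programmes have different ranks, so earlier entries of the owner
      -- table are not overwritten.
      have key : ∀ j < i, ∀ e e', (e = startKey T n i ∨ e = finishKey T i) →
          (e' = startKey T n j ∨ e' = finishKey T j) → rank T n n e' ≠ rank T n n e := by
        intro j hj e e' he he' h
        have := rank_inj (hj.trans hi) hi he' he h
        subst this
        exact hj.ne (index_eq (hj.trans hi) hi he' he)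
      obtain ⟨ha, hb, hc, hd⟩ := hR₂
      constructor <;> intro j hj <;> rcases (Nat.lt_succ_iff_lt_or_eq.1 hj) with hj | rfl
      · simp [Expr.eval, h3₂, h7, h8, hj.ne, ha j hj]
      · simp [Expr.eval, h3₂, h7, h8]
      · simp [Expr.eval, h3₂, h7, h8, hj.ne, hb j hj]
      · simp [Expr.eval, h3₂, h7, h8]
      · simp [Expr.eval, h3₂, h7, h8, hc j hj,
          key j hj _ _ (Or.inl rfl) (Or.inl rfl), key j hj _ _ (Or.inr rfl) (Or.inl rfl)]
      · simp [Expr.eval, h3₂, h7, h8, Function.update_apply]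
      · simp [Expr.eval, h3₂, h7, h8, hd j hj,
          key j hj _ _ (Or.inl rfl) (Or.inr rfl), key j hj _ _ (Or.inr rfl) (Or.inr rfl)]
      · simp [Expr.eval, h3₂, h7, h8]
  · rintro s' ⟨hR, ha⟩
    refine ⟨⟨n, k, s'.arr 2, s'.arr 3, s'.arr 4⟩, hR.valid k hT, rfl, rfl,
      ⟨?_, ?_, ?_, rfl, rfl, rfl⟩, fun i hi j hj => ?_⟩
    · rw [ha.1 0 (by decide)]
      simpa using h0
    · rw [ha.1 1 (by decide)]
      simpa using h1
    · rw [ha.1 2 (by decide)]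
      simp
    · simp only [hR.start i hi, hR.finish j hj, Nat.cast_lt]
      -- Because ends precede simultaneous starts, touching programmes do not intersect in the net
      -- either.
      rw [rank_lt_rank_iff hi hj (Or.inl rfl) (Or.inr rfl), startKey_lt_finishKey hj, not_le]

end TVSlots

namespace TVSlots

namespace Net

variable {G : Net} {x out stk : ℤ → ℤ} {v top : ℤ}

/-! ### Colouring the selected intervals -/

theorem Valid.eq_owner (hG : G.Valid) {i : ℤ} (hi0 : 0 ≤ i) (hi1 : i < G.n)
    (h : G.start i = v ∨ G.finish i = v) : i = G.owner v := by
  rcases h with rfl | rfl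
  · exact (hG.owner_start i hi0 hi1).symm
  · exact (hG.owner_finish i hi0 hi1).symm

/-- Every node is an endpoint of just one interval, so only its owner begins or ceases to cover the
gap there. -/
theorem Valid.depth_step (hG : G.Valid) (h0 : 0 ≤ v) (h1 : v < 2 * G.n) :
    G.depth x v = G.depth x (v - 1) +
      if G.start (G.owner v) = v then x (G.owner v) else - x (G.owner v) := by
  obtain ⟨hi0, hi1, hi2⟩ := hG.owner_spec v h0 h1
  have hsf := hG.start_lt_finish _ hi0 hi1
  have hi : G.owner v ∈ Finset.Ico 0 G.n := by simp [hi0, hi1]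
  unfold depth
  rw [← Finset.add_sum_erase _ _ hi, ← Finset.add_sum_erase _ _ hi]
  have : ∀ j ∈ (Finset.Ico 0 G.n).erase (G.owner v),
      (if G.start j ≤ v ∧ v < G.finish j then x j else 0) =
        if G.start j ≤ v - 1 ∧ v - 1 < G.finish j then x j else 0 := by
    intro j hj
    simp only [Finset.mem_erase, Finset.mem_Ico] at hj
    have : ¬ (G.start j = v ∨ G.finish j = v) := fun h => hj.1 (hG.eq_owner hj.2.1 hj.2.2 h)
    have := hG.start_lt_finish _ hj.2.1 hj.2.2
    congr 1
    apply propext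
    omega
  rw [Finset.sum_congr rfl this]
  split_ifs <;> omega

/-- The intervals that start before node `v` have been coloured by `out`, and the `top` colours not
in use just before `v` are on the stack `stk`. -/
structure Colouring (G : Net) (x out stk : ℤ → ℤ) (v top : ℤ) : Prop where
  top_eq : top + G.depth x (v - 1) = G.k
  stack_mem : ∀ m, 0 ≤ m → m < top → 1 ≤ stk m ∧ stk m ≤ G.k
  stack_inj : ∀ m m', 0 ≤ m → m < top → 0 ≤ m' → m' < top → stk m = stk m' → m = m'
  mem : ∀ i, 0 ≤ i → i < G.n → x i = 1 → G.start i < v → 1 ≤ out i ∧ out i ≤ G.k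
  free : ∀ i, 0 ≤ i → i < G.n → x i = 1 → G.start i < v → v ≤ G.finish i →
    ∀ m, 0 ≤ m → m < top → stk m ≠ out i
  apart : ∀ i j, 0 ≤ i → i < G.n → 0 ≤ j → j < G.n → i ≠ j → x i = 1 → x j = 1 →
    G.start i < v → G.start j < v → G.start i < G.finish j → G.start j < G.finish i → out i ≠ out j
  zero : ∀ i, 0 ≤ i → i < G.n → x i ≠ 1 ∨ v ≤ G.start i → out i = 0

namespace Colouring

theorem skip (hG : G.Valid) (h0 : 0 ≤ v) (h1 : v < 2 * G.n) (H : Colouring G x out stk v top)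
    (hx : x (G.owner v) = 0) : Colouring G x out stk (v + 1) top := by
  have hne : ∀ i, 0 ≤ i → i < G.n → x i = 1 → G.start i ≠ v ∧ G.finish i ≠ v := by
    intro i hi0 hi1 hi
    have : ¬ (G.start i = v ∨ G.finish i = v) := by
      intro h
      have := hG.eq_owner hi0 hi1 h
      subst this
      omega
    tauto
  refine ⟨?_, H.stack_mem, H.stack_inj, ?_, ?_, ?_, ?_⟩
  · have := H.top_eq
    rw [add_sub_cancel_right, hG.depth_step h0 h1, hx]
    simpa using this
  · intro i hi0 hi1 hi hs
    have := hne i hi0 hi1 hi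
    exact H.mem i hi0 hi1 hi (by omega)
  · intro i hi0 hi1 hi hs hf
    have := hne i hi0 hi1 hi
    exact H.free i hi0 hi1 hi (by omega) (by omega)
  · intro i j hi0 hi1 hj0 hj1 hij hi hj hsi hsj
    have := hne i hi0 hi1 hi
    have := hne j hj0 hj1 hj
    exact H.apart i j hi0 hi1 hj0 hj1 hij hi hj (by omega) (by omega)
  · intro i hi0 hi1 hi
    exact H.zero i hi0 hi1 (by omega)

/-- The stack is not empty: before `v` it has `k - depth (v - 1) = k - depth v + 1` entries, which
`hk` makes positive. -/
theorem start (hG : G.Valid) (h0 : 0 ≤ v) (h1 : v < 2 * G.n) (H : Colouring G x out stk v top)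
    (hx : x (G.owner v) = 1) (hv : G.start (G.owner v) = v) (hk : G.depth x v ≤ G.k) :
    Colouring G x (Function.update out (G.owner v) (stk (top - 1))) stk (v + 1) (top - 1) := by
  obtain ⟨hi0, hi1, -⟩ := hG.owner_spec v h0 h1
  have hd := hG.depth_step (x := x) h0 h1
  rw [if_pos hv, hx] at hd
  have htop := H.top_eq
  have hne : ∀ i, 0 ≤ i → i < G.n → i ≠ G.owner v → G.start i ≠ v ∧ G.finish i ≠ v := by
    intro i hi0 hi1 hi
    have : ¬ (G.start i = v ∨ G.finish i = v) := fun h => hi (hG.eq_owner hi0 hi1 h)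
    tauto
  refine ⟨?_, fun m h2 h3 => H.stack_mem m h2 (by omega),
    fun m m' h2 h3 h4 h5 => H.stack_inj m m' h2 (by omega) h4 (by omega), ?_, ?_, ?_, ?_⟩
  · rw [add_sub_cancel_right]
    omega
  · intro i hi0 hi1 hi hs
    by_cases hio : i = G.owner v
    · subst hio
      simpa using H.stack_mem (top - 1) (by omega) (by omega)
    · have := hne i hi0 hi1 hio
      simpa [hio] using H.mem i hi0 hi1 hi (by omega)
  · intro i hi0 hi1 hi hs hf m hm0 hm1
    by_cases hio : i = G.owner v
    · subst hio
      intro h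
      rw [Function.update_self] at h
      have := H.stack_inj m (top - 1) hm0 (by omega) (by omega) (by omega) h
      omega
    · have := hne i hi0 hi1 hio
      simpa [hio] using H.free i hi0 hi1 hi (by omega) (by omega) m hm0 (by omega)
  · intro i j hi0 hi1 hj0 hj1 hij hi hj hsi hsj hij1 hij2
    by_cases hio : i = G.owner v
    · have hjo : j ≠ G.owner v := fun h => hij (hio.trans h.symm)
      have := hne j hj0 hj1 hjo
      simp only [Function.update_of_ne hjo]
      subst hio
      rw [Function.update_self]
      exact H.free j hj0 hj1 hj (by omega) (by omega) _ (by omega) (by omega)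
    · have := hne i hi0 hi1 hio
      simp only [Function.update_of_ne hio]
      by_cases hjo : j = G.owner v
      · subst hjo
        rw [Function.update_self]
        exact (H.free i hi0 hi1 hi (by omega) (by omega) _ (by omega) (by omega)).symm
      · have := hne j hj0 hj1 hjo
        rw [Function.update_of_ne hjo]
        exact H.apart i j hi0 hi1 hj0 hj1 hij hi hj (by omega) (by omega) hij1 hij2
  · intro i hi0 hi1 hi
    have hio : i ≠ G.owner v := by
      rintro rfl
      omega
    rw [Function.update_of_ne hio]
    exact H.zero i hi0 hi1 (by omega)

/-- The colour returned to the stack is not already there by `free`, and by `apart` no interval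
still running uses it. -/
theorem finish (hG : G.Valid) (h0 : 0 ≤ v) (h1 : v < 2 * G.n) (H : Colouring G x out stk v top)
    (hx : x (G.owner v) = 1) (hv : G.start (G.owner v) ≠ v) (htop : 0 ≤ top) :
    Colouring G x out (Function.update stk top (out (G.owner v))) (v + 1) (top + 1) := by
  obtain ⟨ho0, ho1, ho2⟩ := hG.owner_spec v h0 h1
  have hosf := hG.start_lt_finish _ ho0 ho1
  have hd := hG.depth_step (x := x) h0 h1
  rw [if_neg hv, hx] at hd
  have hte := H.top_eq
  have hfree := H.free _ ho0 ho1 hx (by omega) (by omega)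
  have hne : ∀ i, 0 ≤ i → i < G.n → i ≠ G.owner v → G.start i ≠ v ∧ G.finish i ≠ v := by
    intro i hi0 hi1 hi
    have : ¬ (G.start i = v ∨ G.finish i = v) := fun h => hi (hG.eq_owner hi0 hi1 h)
    tauto
  have hs' : ∀ i, 0 ≤ i → i < G.n → G.start i < v + 1 → G.start i < v := by
    intro i hi0 hi1 hi
    by_cases hio : i = G.owner v
    · subst hio
      omega
    · have := hne i hi0 hi1 hio
      omega
  refine ⟨?_, fun m h2 h3 => ?_, fun m m' h2 h3 h4 h5 h6 => ?_,
    fun i hi0 hi1 hi hs => H.mem i hi0 hi1 hi (hs' i hi0 hi1 hs), ?_, ?_, ?_⟩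
  · rw [add_sub_cancel_right]
    omega
  · by_cases hm : m = top
    · subst hm
      simpa using H.mem _ ho0 ho1 hx (by omega)
    · simpa [hm] using H.stack_mem m h2 (by omega)
  · by_cases hm : m = top <;> by_cases hm' : m' = top
    · omega
    · subst hm
      rw [Function.update_self, Function.update_of_ne hm'] at h6
      exact absurd h6.symm (hfree m' h4 (by omega))
    · subst hm'
      rw [Function.update_self, Function.update_of_ne hm] at h6
      exact absurd h6 (hfree m h2 (by omega))
    · rw [Function.update_of_ne hm, Function.update_of_ne hm'] at h6
      exact H.stack_inj m m' h2 (by omega) h4 (by omega) h6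
  · intro i hi0 hi1 hi hs hf m hm0 hm1
    have hio : i ≠ G.owner v := by
      rintro rfl
      omega
    have hs := hs' i hi0 hi1 hs
    by_cases hm : m = top
    · subst hm
      rw [Function.update_self]
      exact H.apart _ _ ho0 ho1 hi0 hi1 hio.symm hx hi (by omega) hs (by omega) (by omega)
    · rw [Function.update_of_ne hm]
      exact H.free i hi0 hi1 hi hs (by omega) m hm0 (by omega)
  · intro i j hi0 hi1 hj0 hj1 hij hi hj hsi hsj
    exact H.apart i j hi0 hi1 hj0 hj1 hij hi hj (hs' i hi0 hi1 hsi) (hs' j hj0 hj1 hsj)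
  · intro i hi0 hi1 hi
    exact H.zero i hi0 hi1 (by omega)

end Colouring

theorem Valid.depth_neg_one (hG : G.Valid) : G.depth x (-1) = 0 := by
  refine Finset.sum_eq_zero fun i hi => if_neg fun h => ?_
  simp only [Finset.mem_Ico] at hi
  have := hG.start_nonneg i hi.1 hi.2
  omega

theorem Valid.depth_last (hG : G.Valid) : G.depth x (2 * G.n - 1) = 0 := by
  refine Finset.sum_eq_zero fun i hi => if_neg fun h => ?_
  simp only [Finset.mem_Ico] at hi
  have := hG.finish_lt i hi.1 hi.2
  omega

end Net

/-! ### The colouring program -/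

/-- Assign sessions to the selected programmes. -/
def colour : Prog :=
  .for 6 1 (.put 12 (.reg 6) (.add (.reg 6) (.const 1))) ;; .set 7 (.reg 1) ;;
    .for 6 2 (.set 10 (.get 4 (.reg 6)) ;;
      .ite (.eq (.get 8 (.reg 10)) (.const 1))
        (.ite (.eq (.get 2 (.reg 10)) (.reg 6))
          (.set 7 (.sub (.reg 7) (.const 1)) ;; .put 1 (.reg 10) (.get 12 (.reg 7)))
          (.put 12 (.reg 7) (.get 1 (.reg 10)) ;; .set 7 (.add (.reg 7) (.const 1))))
        .skip)

theorem colour_halts {T : TimeTable → ℤ → ℝ} {G : Net} {s : State} (hG : G.Valid) {n k : ℕ}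
    (hn : G.n = n) (hk : G.k = k) (hs : s.HasNet G) (h1 : ∀ i, s.arr 1 i = 0)
    (hx : ∀ i, 0 ≤ i → i < G.n → s.arr 8 i = 0 ∨ s.arr 8 i = 1)
    (hd : ∀ v, 0 ≤ v → v + 1 < 2 * G.n → G.depth (s.arr 8) v ≤ G.k) :
    Halts T colour s (k * 14 + n * 100 + 30) fun s' => ∃ stk top,
      Net.Colouring G (s.arr 8) (s'.arr 1) stk (2 * G.n) top := by
  -- The sweep also consults the depth before the first node and after the last one, where it is
  -- zero.
  have hd' : ∀ v, -1 ≤ v → v < 2 * G.n → G.depth (s.arr 8) v ≤ G.k := by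
    intro v h0 h2
    by_cases h3 : v = -1
    · rw [h3, hG.depth_neg_one]
      omega
    · by_cases h4 : v = 2 * G.n - 1
      · rw [h4, hG.depth_last]
        omega
      · exact hd v (by omega) (by omega)
  refine Halts.mono (Halts.seq (Halts.for (B := 5) 6 1 k
    (fun m s' => ∀ i : ℤ, 0 ≤ i → i < m → s'.arr 12 i = i + 1) (by decide) (by decide) (by decide)
    (by rw [hs.k, hk]) (by intros; omega) ?_) (B' := 2 + (2 * n * (34 + 9) + 7)) ?_) (by omega)
    fun _ h => h
  · intro i s' hi ha h6 hI
    refine Halts.mono (Prog.wp.halts ?_) (by decide) fun _ h => h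
    intro j hj0 hj1
    by_cases hj : j = i
    · simp [Expr.eval, h6, hj]
    · have := hI j hj0 (by push_cast at hj1; omega)
      simpa [Expr.eval, h6, hj] using this
  rintro s₁ ⟨hstk, ha⟩
  have hs₁ := ha.hasNet hs
  have h8₁ : s₁.arr 8 = s.arr 8 := ha.2 8 (by decide)
  have h1₁ : s₁.arr 1 = s.arr 1 := ha.2 1 (by decide)
  refine Halts.seq (B := 2) (R := fun s' => s' = s₁.setReg 7 k)
    ⟨_, _, .set _ _ _, by decide, by simp [Expr.eval, hs₁.k, hk]⟩ ?_
  rintro _ rfl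
  refine (Halts.for 6 2 (2 * n) (fun m s' =>
    Net.Colouring G (s.arr 8) (s'.arr 1) (s'.arr 12) m (s'.reg 7)) (by decide) (by decide)
    (by decide) (by simp [hs₁.nodes, hn]) ?_ ?_).mono le_rfl ?_
  · have hneg : ∀ i, 0 ≤ i → i < G.n → ¬ G.start i < 0 := fun i h2 h3 =>
      not_lt.2 (hG.start_nonneg i h2 h3)
    constructor
    · simp [hG.depth_neg_one, hk]
    · intro m h2 h3
      have := hstk m h2 (by simpa using h3)
      simp [this]
      simp at h3
      omega
    · intro m m' h2 h3 h4 h5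
      have := hstk m h2 (by simpa using h3)
      have := hstk m' h4 (by simpa using h5)
      simp [*]
    · intro i h2 h3 h4 h5
      exact absurd h5 (hneg i h2 h3)
    · intro i h2 h3 h4 h5
      exact absurd h5 (hneg i h2 h3)
    · intro i j h2 h3 _ _ _ _ _ h5
      exact absurd h5 (hneg i h2 h3)
    · intro i _ _ _
      simp [h1₁, h1]
  · intro v s' hv ha' h6 H
    have hn' : s'.HasNet G :=
      ha'.hasNet ⟨hs₁.n, hs₁.k, hs₁.nodes, hs₁.start, hs₁.finish, hs₁.owner⟩
    have h8 : s'.arr 8 = s.arr 8 := by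
      rw [ha'.2 8 (by decide), ← h8₁]
      rfl
    have hv1 : (v : ℤ) < 2 * G.n := by omega
    have hv0 : (0 : ℤ) ≤ v := by omega
    obtain ⟨ho0, ho1, -⟩ := hG.owner_spec v hv0 hv1
    have hx' := hx _ ho0 ho1
    refine Halts.mono (Prog.wp.halts ?_) (by decide) fun _ h => h
    refine ⟨fun h2 => ⟨fun h3 => ?_, fun h3 => ?_⟩, fun h2 => ?_⟩ <;>
      simp [Expr.eval, h6, hn'.owner, h8] at h2
    · simp [Expr.eval, h6, hn'.owner, hn'.start] at h3
      have := H.start hG hv0 hv1 h2 h3 (hd' v (by omega) hv1)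
      simpa [Prog.wp, Expr.eval, h6, hn'.owner] using this
    · simp [Expr.eval, h6, hn'.owner, hn'.start] at h3
      have := H.finish hG hv0 hv1 h2 h3 (by
        have := H.top_eq
        have := hd' (v - 1) (by omega) (by omega)
        omega)
      simpa [Prog.wp, Expr.eval, h6, hn'.owner] using this
    · have := H.skip hG hv0 hv1 (hx'.resolve_right h2)
      simpa [Prog.wp] using this
  · rintro s' ⟨h2, -⟩
    exact ⟨s'.arr 12, s'.reg 7, by simpa [hn] using h2⟩

end TVSlots

namespace TVSlots

namespace Net

variable {G : Net} {f : Flow} {x : ℤ → ℤ}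

/-! ### Optimality -/

theorem sum_Ico_telescope (p : ℤ → ℤ) {a b : ℤ} (hab : a ≤ b) :
    ∑ v ∈ Finset.Ico a b, (p (v + 1) - p v) = p b - p a := by
  induction b, hab using Int.leInduction with
  | base => simp
  | succ b hb ih =>
    have : Finset.Ico a (b + 1) = insert b (Finset.Ico a b) := by
      ext v
      simp only [Finset.mem_Ico, Finset.mem_insert]
      omega
    rw [this, Finset.sum_insert (by simp), ih]
    ring

/-- The cost of an interval telescopes into the price increments of the gaps it covers; exchanging
the two sums collects the depth of each gap. -/
theorem Valid.sum_cost (hG : G.Valid) (f : Flow) (x : ℤ → ℤ) :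
    ∑ i ∈ Finset.Ico 0 G.n, x i * G.cost f i =
      ∑ v ∈ Finset.Ico 0 (2 * G.n - 1), (f.price (v + 1) - f.price v) * G.depth x v := by
  simp only [depth, Finset.mul_sum]
  rw [Finset.sum_comm]
  refine Finset.sum_congr rfl fun i hi => ?_
  simp only [Finset.mem_Ico] at hi
  have h1 := hG.start_nonneg i hi.1 hi.2
  have h2 := hG.start_lt_finish i hi.1 hi.2
  have h3 := hG.finish_lt i hi.1 hi.2
  rw [cost, ← sum_Ico_telescope f.price h2.le, Finset.mul_sum]
  symm
  have hsub : Finset.Ico (G.start i) (G.finish i) ⊆ Finset.Ico 0 (2 * G.n - 1) :=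
    Finset.Ico_subset_Ico h1 (by omega)
  rw [← Finset.sum_subset hsub]
  · refine Finset.sum_congr rfl fun v hv => ?_
    rw [if_pos (Finset.mem_Ico.1 hv), mul_comm]
  · intro v _ hv
    rw [Finset.mem_Ico] at hv
    rw [if_neg hv, mul_zero]

/-- The selection of a flow satisfying complementary slackness has maximum weight. -/
theorem Kilter.sum_le (hG : G.Valid) (H : G.Kilter f)
    (hx : ∀ i, 0 ≤ i → i < G.n → x i = 0 ∨ x i = 1)
    (hd : ∀ v, 0 ≤ v → v + 1 < 2 * G.n → G.depth x v ≤ G.k) :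
    ∑ i ∈ Finset.Ico 0 G.n, x i * f.weight i ≤ ∑ i ∈ Finset.Ico 0 G.n, f.sel i * f.weight i := by
  -- Reduced weights are compared interval by interval, costs gap by gap: an increment is either
  -- zero or belongs to a gap where the flow attains the maximum depth `k`.
  have h1 : ∑ i ∈ Finset.Ico 0 G.n, x i * (f.weight i - G.cost f i) ≤
      ∑ i ∈ Finset.Ico 0 G.n, f.sel i * (f.weight i - G.cost f i) := by
    refine Finset.sum_le_sum fun i hi => ?_
    rw [Finset.mem_Ico] at hi
    obtain ⟨h1, h2, h3⟩ := H.interval i hi.1 hi.2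
    rcases h1 with h1 | h1
    · have := h3 h1
      rcases hx i hi.1 hi.2 with h4 | h4 <;> rw [h1, h4]
      omega
    · have := h2 h1
      rcases hx i hi.1 hi.2 with h4 | h4 <;> rw [h1, h4]
      omega
  have h2 : ∑ i ∈ Finset.Ico 0 G.n, x i * G.cost f i ≤
      ∑ i ∈ Finset.Ico 0 G.n, f.sel i * G.cost f i := by
    rw [hG.sum_cost, hG.sum_cost]
    refine Finset.sum_le_sum fun v hv => ?_
    rw [Finset.mem_Ico] at hv
    have h3 := H.gap.mono v hv.1 (by omega)
    have h4 := hd v hv.1 (by omega)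
    rw [← H.load v hv.1 (by omega)]
    rcases H.gap.tight v hv.1 (by omega) with h5 | h5
    · simp [h5]
    · rw [h5]
      exact mul_le_mul_of_nonneg_left h4 (by omega)
  have h3 := add_le_add h1 h2
  simp only [← Finset.sum_add_distrib, ← mul_add, sub_add_cancel] at h3
  exact h3

end Net

theorem sum_Ico_eq_sum_fin {n : ℕ} (g : ℤ → ℤ) :
    ∑ i ∈ Finset.Ico (0 : ℤ) n, g i = ∑ i : Fin n, g (i : ℕ) := by
  symm
  refine Finset.sum_bij (fun i _ => ((i : ℕ) : ℤ)) ?_ ?_ ?_ ?_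
  · intro i _
    simp
  · intro i _ j _ h
    exact Fin.ext (by exact_mod_cast h)
  · intro i hi
    rw [Finset.mem_Ico] at hi
    exact ⟨⟨i.toNat, by omega⟩, Finset.mem_univ _, by simp [hi.1]⟩
  · intro i _
    rfl

/-! ### From flows in the net to selections of programmes -/

section Selection

variable {n k : ℕ} {S : Schedule n}

/-- `G` is the net of the schedule `S`. -/
structure Net.Represents (G : Net) (S : Schedule n) (k : ℕ) : Prop where
  valid : G.Valid
  n_eq : G.n = n
  k_eq : G.k = k
  lt_iff : ∀ i j : Fin n, G.start (i : ℕ) < G.finish (j : ℕ) ↔ S.start i < S.finish j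

variable {G : Net}

open Classical in
/-- The characteristic function of the selected programmes. -/
noncomputable def indicator (H : Fin k → Finset (Fin n)) : ℤ → ℤ :=
  toArray fun i => if ∃ c, i ∈ H c then (1 : ℤ) else 0

theorem toArray_coe {α : Type} [Zero α] (g : Fin n → α) (i : Fin n) :
    toArray g ((i : ℕ) : ℤ) = g i := by
  simp [toArray]

open Classical in
theorem Schedule.IsSelection.total_eq {H : Fin k → Finset (Fin n)} (hH : S.IsSelection H) :
    (S.total H : ℤ) = ∑ i : Fin n, indicator H (i : ℕ) * (S.viewers i : ℤ) := by
  have : S.total H = ∑ i ∈ Finset.univ.biUnion H, S.viewers i := by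
    rw [Finset.sum_biUnion fun c _ d _ h => hH.disjoint c d h]
    rfl
  rw [this, Nat.cast_sum]
  simp only [indicator, toArray_coe, ite_mul, one_mul, zero_mul]
  rw [← Finset.sum_filter]
  congr 1
  ext i
  simp

theorem indicator_mem (H : Fin k → Finset (Fin n)) (i : ℤ) : indicator H i = 0 ∨ indicator H i = 1 := by
  classical
  unfold indicator toArray
  split
  · dsimp only
    split_ifs <;> simp
  · simp

open Classical in
-- Selected programmes over a common gap intersect pairwise, so sending each to its session is
-- injective into `Fin k`.
theorem Net.Represents.depth_le (hG : G.Represents S k) {H : Fin k → Finset (Fin n)}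
    (hH : S.IsSelection H) (v : ℤ) : G.depth (indicator H) v ≤ G.k := by
  unfold Net.depth
  rw [hG.n_eq, hG.k_eq, sum_Ico_eq_sum_fin]
  simp only [indicator, toArray_coe, ← ite_and]
  rw [Finset.sum_boole]
  set A := Finset.univ.filter fun i : Fin n =>
    (G.start (i : ℕ) ≤ v ∧ v < G.finish (i : ℕ)) ∧ ∃ c, i ∈ H c with hA
  have hc : ∀ i ∈ A, ∃ c, i ∈ H c := fun i hi => (Finset.mem_filter.1 hi).2.2
  rcases A.eq_empty_or_nonempty with hA0 | ⟨a, ha⟩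
  · simp [hA0]
  have : Nonempty (Fin k) := ⟨(hc a ha).choose⟩
  choose! col hcol using hc
  have := Finset.card_le_card_of_injOn (s := A) (t := Finset.univ) col (fun _ _ => Finset.mem_univ _) ?_
  · simpa using this
  · intro i hi j hj hij
    by_contra hne
    have hi' := (Finset.mem_filter.1 hi).2.1
    have hj' := (Finset.mem_filter.1 hj).2.1
    have h1 := hcol i hi
    have h2 := hcol j hj
    rw [hij] at h1
    exact hH.session _ h1 h2 hne ⟨hne, (hG.lt_iff i j).1 (by omega), (hG.lt_iff j i).1 (by omega)⟩

/-- The colour classes form the selection. Any rival selection has an indicator of depth at most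
`k`, so `Net.Kilter.sum_le` bounds its number of viewers. -/
theorem Net.Represents.outputs (hG : G.Represents S k) {f : Flow} (hf : G.Kilter f)
    (hw : ∀ i : Fin n, f.weight (i : ℕ) = S.viewers i) {out stk : ℤ → ℤ} {top : ℤ}
    (hc : Net.Colouring G f.sel out stk (2 * G.n) top) {s : State} (hs : s.arr 1 = out) :
    ∃ H : Fin k → Finset (Fin n), s.Outputs H ∧ S.IsOptimal H := by
  have hi0 : ∀ i : Fin n, (0 : ℤ) ≤ (i : ℕ) := fun i => by omega
  have hi1 : ∀ i : Fin n, ((i : ℕ) : ℤ) < G.n := fun i => by rw [hG.n_eq]; omega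
  have hlt : ∀ i : Fin n, G.start (i : ℕ) < 2 * G.n := fun i =>
    (hG.valid.start_lt_finish _ (hi0 i) (hi1 i)).trans (hG.valid.finish_lt _ (hi0 i) (hi1 i))
  have hsel : ∀ i : Fin n, f.sel (i : ℕ) = 0 ∨ f.sel (i : ℕ) = 1 := fun i =>
    (hf.interval _ (hi0 i) (hi1 i)).sel_mem
  have hout : ∀ i : Fin n, f.sel (i : ℕ) = 1 → 1 ≤ out (i : ℕ) ∧ out (i : ℕ) ≤ k := fun i hi => by
    have := hc.mem _ (hi0 i) (hi1 i) hi (hlt i)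
    rwa [hG.k_eq] at this
  have hzero : ∀ i : Fin n, f.sel (i : ℕ) = 0 → out (i : ℕ) = 0 := fun i hi =>
    hc.zero _ (hi0 i) (hi1 i) (Or.inl (by omega))
  let H : Fin k → Finset (Fin n) := fun c =>
    Finset.univ.filter fun i => out (i : ℕ) = ((c : ℕ) : ℤ) + 1
  have hmem : ∀ c i, i ∈ H c ↔ out (i : ℕ) = ((c : ℕ) : ℤ) + 1 := fun c i => by simp [H]
  have hex : ∀ i : Fin n, f.sel (i : ℕ) = 1 → ∃ c, i ∈ H c := fun i hi => by
    have := hout i hi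
    -- Colours run from `1` to `k`, with `0` kept for unselected programmes, whereas `Fin k` starts
    -- at `0`.
    exact ⟨⟨(out (i : ℕ)).toNat - 1, by omega⟩, (hmem _ i).2 (by simp only; omega)⟩
  have hone : ∀ i c, i ∈ H c → f.sel (i : ℕ) = 1 := fun i c hi => by
    rw [hmem] at hi
    refine (hsel i).resolve_left fun h => ?_
    rw [hzero i h] at hi
    omega
  have hH : S.IsSelection H := by
    constructor
    · intro c d hcd
      rw [Finset.disjoint_left]
      intro i h1 h2
      rw [hmem] at h1 h2
      exact hcd (Fin.ext (by omega))
    · intro c i hi j hj hij hadj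
      have h1 := hone i c hi
      have h2 := hone j c hj
      rw [Finset.mem_coe, hmem] at hi hj
      refine hc.apart _ _ (hi0 i) (hi1 i) (hi0 j) (hi1 j)
        (fun h => hij (Fin.ext (by exact_mod_cast h))) h1 h2 (hlt i) (hlt j)
        ((hG.lt_iff i j).2 hadj.2.1) ((hG.lt_iff j i).2 hadj.2.2) (by omega)
  refine ⟨H, fun i => ?_, hH, fun H' hH' => ?_⟩
  · rw [hs]
    rcases hsel i with h | h
    · refine Or.inr ⟨fun c hi => ?_, hzero i h⟩
      have := hone i c hi
      omega
    · obtain ⟨c, hi⟩ := hex i h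
      exact Or.inl ⟨c, hi, (hmem c i).1 hi⟩
  · have key := hf.sum_le hG.valid (x := indicator H') (fun i _ _ => indicator_mem H' i)
      fun v _ _ => hG.depth_le hH' v
    rw [hG.n_eq, sum_Ico_eq_sum_fin, sum_Ico_eq_sum_fin] at key
    simp only [hw] at key
    rw [← hH'.total_eq] at key
    have heq : (S.total H : ℤ) = ∑ i : Fin n, f.sel (i : ℕ) * (S.viewers i : ℤ) := by
      classical
      rw [hH.total_eq]
      refine Finset.sum_congr rfl fun i _ => ?_
      congr 1
      simp only [indicator, toArray_coe]
      split_ifs with h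
      · obtain ⟨c, hi⟩ := h
        exact (hone i c hi).symm
      · exact ((hsel i).resolve_right fun h' => h (hex i h')).symm
    rw [← heq] at key
    exact_mod_cast key

end Selection

/-! ### The complete algorithm and its running time -/

/-- Select programmes for parallel sessions. -/
def selectProgrammes : Prog := sortEndpoints ;; optimize ;; colour

theorem selectProgrammes_halts {n k M : ℕ} (S : Schedule n) (hM : ∀ i, S.viewers i ≤ M) :
    Halts S.times selectProgrammes (S.initial k)
      ((n * (n * 60 + 32) + 11) + ((n * (M * (n * 600 + 159) + 20) + 7) + (k * 14 + n * 100 + 30)))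
      fun s => ∃ H : Fin k → Finset (Fin n), s.Outputs H ∧ S.IsOptimal H := by
  have hw : ∀ i, 0 ≤ (S.initial k).arr 0 i ∧ (S.initial k).arr 0 i ≤ M := by
    intro i
    simp only [Schedule.initial, if_true, toArray]
    split_ifs
    · have := hM ⟨i.toNat, by tauto⟩
      omega
    · omega
  refine (sortEndpoints_halts (n := n) (k := k) rfl rfl fun i hi => ?_).agree.seq ?_
  · have := S.start_lt_finish ⟨i, hi⟩
    simpa [Schedule.times, toArray, hi] using this
  rintro s₁ ⟨⟨G, hG, hn, hk, hs₁, hlt⟩, ha⟩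
  have harr : ∀ a, a = 0 ∨ (a ≠ 2 ∧ a ≠ 3 ∧ a ≠ 4) → s₁.arr a = (S.initial k).arr a := by
    intro a h
    refine ha.2 a ?_
    simp only [sortEndpoints, Prog.for, rankStep, countIf, Prog.arrs]
    simp
    omega
  have hzero : ∀ a, 5 ≤ a ∨ a = 1 → s₁.arr a = fun _ => 0 := by
    intro a h
    rw [harr a (by omega)]
    simp [Schedule.initial, show a ≠ 0 by omega]
  have hrep : G.Represents S k := by
    refine ⟨hG, hn, hk, fun i j => ?_⟩
    rw [hlt i i.2 j j.2]
    simp [Schedule.times, toArray_coe]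
  -- Untouched arrays are zero, and the zero flow with zero prices is optimal for zero weights.
  have hkil : G.Kilter s₁.flow := by
    have hf : s₁.flow = ⟨fun _ => 0, fun _ => 0, fun _ => 0, fun _ => 0⟩ := by
      simp [State.flow, hzero]
    rw [hf]
    refine ⟨fun i _ _ => ⟨Or.inl rfl, fun h => ?_, fun _ => ?_⟩, ⟨?_, ?_, ?_⟩, ?_⟩
    · simp at h
    · simp [Net.cost]
    · simp
    · intro v _ _
      simp [hk]
    · simp
    · intro v _ _
      simp [Net.depth]
  refine (optimize_halts hG hn hs₁ hkil (fun i => by rw [hzero 7 (by omega)])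
    (fun i => by rw [harr 0 (by omega)]; exact (hw i).1)
    (fun i => by rw [harr 0 (by omega)]; exact (hw i).2)).agree.seq ?_
  rintro s₂ ⟨⟨hs₂, hkil₂, h7⟩, ha₂⟩
  refine (colour_halts hG hn hk hs₂ (fun i => ?_)
    (fun i h0 h1 => (hkil₂.interval i h0 h1).sel_mem)
    (fun v h0 h1 => ?_)).mono le_rfl ?_
  · rw [ha₂.2 1 (by decide), hzero 1 (by omega)]
  · have h2 := hkil₂.load v h0 (by omega)
    have h3 := hkil₂.gap.load_le v h0 h1
    rw [h2] at h3
    exact h3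
  · rintro s₃ ⟨stk, top, hc⟩
    refine hrep.outputs hkil₂ (fun i => ?_) hc rfl
    have := h7 (i : ℕ) (by omega) (by omega)
    rw [harr 0 (by omega)] at this
    simpa [Schedule.initial, toArray_coe, State.flow] using this

end TVSlots

theorem mainTheorem5 :
    ∃ (p : TVSlots.Prog) (C : ℕ), ∀ (n k M : ℕ) (S : TVSlots.Schedule n),
      1 ≤ n → 1 ≤ k → 1 ≤ M → (∀ i, S.viewers i ≤ M) →
      ∃ (t : ℕ) (s : TVSlots.State) (H : Fin k → Finset (Fin n)),
        TVSlots.Runs S.times p (S.initial k) t s ∧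
        t ≤ C * (k * M * n ^ 2) ∧
        s.Outputs H ∧ S.IsOptimal H := by
  refine ⟨TVSlots.selectProgrammes, 2000, fun n k M S hn hk hM hv => ?_⟩
  obtain ⟨t, s, hr, ht, H, hH⟩ := TVSlots.selectProgrammes_halts (k := k) S hv
  refine ⟨t, s, H, hr, ht.trans ?_, hH⟩
  -- The actual bound is of order `M * n ^ 2 + k`. Each of its monomials is at most `k * M * n ^ 2`,
  -- and the coefficients add up to less than `2000`.
  have h1 : n ^ 2 ≤ k * M * n ^ 2 := Nat.le_mul_of_pos_left _ (Nat.mul_pos hk hM)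
  have h2 : n ≤ n ^ 2 := Nat.le_self_pow two_ne_zero n
  have h3 : k ≤ k * M * n ^ 2 := by
    rw [mul_assoc]
    exact Nat.le_mul_of_pos_right _ (Nat.mul_pos hM (pow_pos hn 2))
  have h4 : M * n ^ 2 ≤ k * M * n ^ 2 := Nat.mul_le_mul_right _ (Nat.le_mul_of_pos_left _ hk)
  have h5 : M * n ≤ M * n ^ 2 := Nat.mul_le_mul_left _ h2
  nlinarith
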